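/- Let $K$ be a field of characteristic $0$ and let $\mathcal S$ be the ring of symmetric functions over $K$: the formal power series of bounded degree in countably many variables that are invariant under all permutations of the variables. Partitions are identified with their Young diagrams, and $\lambda'$ denotes the conjugate of $\lambda$. For partitions $\mu\subseteq\lambda$, let $S_{\lambda/\mu}=\sum_T x^T$ be the skew Schur function, the sum over all semistandard tableaux $T$ of shape $\lambda/\mu$, and let $S_\lambda=S_{\lambda/\emptyset}$; write $S_{(\lambda/\mu)'}=S_{\lambda'/\mu'}$. For finite (possibly empty) sets of variables $X=\{x_1,\dots,x_k\}$, $Y=\{y_1,\dots,y_\ell\}$ let $S_\lambda(X,Y)$ be the Schur polynomial in the $k+\ell$ variables $x_1,\dots,x_k,y_1,\dots,y_\ell$, and let $HS_\lambda(X;Y)=\sum_T x^T$ be the hook Schur function: the sum is over all fillings $T$ of the diagram of $\lambda$ with letters from $1<\dots<k<1'<\dots<\ell'$ whose rows and columns are weakly increasing, in which no unprimed letter repeats in a column and no primed letter repeats in a row, where $x^T$ has a factor $x_i$ for each entry $i$ and a factor $y_j$ for each entry $j'$. A symmetric function $\sum_\lambda m_\lambda S_\lambda$ (finite sum, $m_\lambda\in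 K$) is *doubly symmetric* if $\sum_\lambda m_\lambda S_\lambda(X,Y)=\sum_\lambda m_\lambda HS_\lambda(X;Y)$ for all such $X$ and $Y$. Let $\mathcal D\subseteq\mathcal S$ be the set of doubly symmetric functions. Let $p_n=\sum_i x_i^n$ for $n\ge1$, and $p_\lambda=\prod_i p_{\lambda_i}$, the product over the parts of $\lambda$ (so $p_\emptyset=1$); call $\lambda$ *odd* if all its parts are odd. Let $DS_\lambda=\sum_{\mu\subseteq\lambda}S_\mu S_{(\lambda/\mu)'}$, and for $n\ge1$ let $k_n=\sum_{a+b=n,\ a\ge1,\ b\ge0}S_{(a,1^b)}$. Then: 1. $\mathcal D$ is a subalgebra of $\mathcal S$, and it is generated as a $K$-algebra by $\{p_n\mid n\text{ odd}\}$; 2. the family $(p_\lambda)$, $\lambda$ ranging over the odd partitions, is a $K$-basis of $\mathcal D$; 3. $\mathcal D$ is spanned over $K$ by the doubly Schur functions $DS_\lambda$, $\lambda$ ranging over all partitions; 4. $\mathcal D$ is generated as a $K$-algebra by $\{k_n\mid n\ge1\}$. -/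

import Mathlib

open scoped BigOperators

noncomputable section

namespace DoublySym

/-- The ring of symmetric functions over `K` in the variables `x_0, x_1, x_2, …`: formal power
series of bounded degree that are invariant under all permutations of the variables. -/
def symmetricFunctions (K : Type*) [Field K] : Subalgebra K (MvPowerSeries ℕ K) where
  carrier := {f | (∃ N : ℕ, ∀ d : ℕ →₀ ℕ, N < d.degree → MvPowerSeries.coeff d f = 0) ∧
    ∀ (σ : Equiv.Perm ℕ) (d : ℕ →₀ ℕ),
      MvPowerSeries.coeff (d.mapDomain σ) f = MvPowerSeries.coeff d f}
  mul_mem' := by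
    classical
    rintro f g ⟨⟨M, hM⟩, hf⟩ ⟨⟨N, hN⟩, hg⟩
    refine ⟨⟨M + N, fun d hd => ?_⟩, fun σ d => ?_⟩
    · rw [MvPowerSeries.coeff_mul]
      refine Finset.sum_eq_zero fun p hp => ?_
      have h := congrArg Finsupp.degree (Finset.HasAntidiagonal.mem_antidiagonal.1 hp)
      rw [map_add] at h
      rcases Nat.lt_or_ge M p.1.degree with h1 | h1
      · rw [hM _ h1, zero_mul]
      · rw [hN _ (by omega), mul_zero]
    · rw [MvPowerSeries.coeff_mul, MvPowerSeries.coeff_mul]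
      symm
      have key : ∀ (τ : Equiv.Perm ℕ) (a : ℕ →₀ ℕ),
          (a.mapDomain τ).mapDomain τ.symm = a := fun τ a => by
        rw [← Finsupp.mapDomain_comp]; simp
      refine Finset.sum_bij' (fun p _ => (p.1.mapDomain σ, p.2.mapDomain σ))
        (fun p _ => (p.1.mapDomain σ.symm, p.2.mapDomain σ.symm)) ?_ ?_ ?_ ?_ ?_
      · intro p hp
        rw [Finset.HasAntidiagonal.mem_antidiagonal] at hp ⊢
        simp only [← hp, Finsupp.mapDomain_add]
      · intro p hp
        rw [Finset.HasAntidiagonal.mem_antidiagonal] at hp ⊢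
        simp only [← Finsupp.mapDomain_add, hp, key]
      · intro p _
        simp [key]
      · intro p _
        have := key σ.symm
        simp only [Equiv.symm_symm] at this
        simp [this]
      · intro p _
        simp only [hf, hg]
  add_mem' := by
    rintro f g ⟨⟨M, hM⟩, hf⟩ ⟨⟨N, hN⟩, hg⟩
    refine ⟨⟨M + N, fun d hd => ?_⟩, fun σ d => ?_⟩
    · rw [map_add, hM d (by omega), hN d (by omega), add_zero]
    · rw [map_add, map_add, hf, hg]
  algebraMap_mem' := by
    classical
    intro r
    refine ⟨⟨0, fun d hd => ?_⟩, fun σ d => ?_⟩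
    · rw [MvPowerSeries.algebraMap_apply, MvPowerSeries.coeff_C, if_neg]
      rintro rfl
      simp at hd
    · have h : d.mapDomain σ = 0 ↔ d = 0 := by
        refine ⟨fun h => Finsupp.mapDomain_injective σ.injective ?_, ?_⟩
        · rw [h, Finsupp.mapDomain_zero]
        · rintro rfl
          exact Finsupp.mapDomain_zero
      simp only [MvPowerSeries.algebraMap_apply, MvPowerSeries.coeff_C, h]

/-- A filling `T` of the skew shape `lam/mu` by letters of an ordered alphabet `A`, some of whose
letters are primed, is a semistandard tableau if its entries are weakly increasing along rows
(to the right) and columns (downwards), primed letters do not repeat in a row, and unprimed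
letters do not repeat in a column. Cells are pairs (row, column). With no primed letters these
are the ordinary semistandard tableaux. -/
structure IsTableau {A : Type*} [LinearOrder A] (primed : A → Prop) {lam mu : YoungDiagram}
    (T : ↥(lam.cells \ mu.cells) → A) : Prop where
  row_weak : ∀ c c', c.1.1 = c'.1.1 → c.1.2 < c'.1.2 → T c ≤ T c'
  col_weak : ∀ c c', c.1.2 = c'.1.2 → c.1.1 < c'.1.1 → T c ≤ T c'
  row_primed : ∀ c c', c.1.1 = c'.1.1 → c.1.2 < c'.1.2 → primed (T c) → T c ≠ T c'
  col_unprimed : ∀ c c', c.1.2 = c'.1.2 → c.1.1 < c'.1.1 → ¬ primed (T c) → T c ≠ T c'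

/-- The exponent vector of the monomial `x^T`: how often each letter occurs in `T`. -/
def content {A : Type*} {lam mu : YoungDiagram} (T : ↥(lam.cells \ mu.cells) → A) : A →₀ ℕ :=
  ∑ c, Finsupp.single (T c) 1

/-- The generating function `∑_T x^T` over the semistandard tableaux `T` of shape `lam/mu` in the
alphabet `A`: the coefficient of `x^d` is the (finite) number of such `T` with content `d`. -/
def tableauSeries (K : Type*) [Field K] {A : Type*} [LinearOrder A] (primed : A → Prop)
    (lam mu : YoungDiagram) : MvPowerSeries A K :=
  fun d => (Nat.card {T : ↥(lam.cells \ mu.cells) → A // IsTableau primed T ∧ content T = d} : K)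

/-- The skew Schur function `S_{lam/mu}`, as a symmetric function in `x_0, x_1, …`. -/
def skewSchur (K : Type*) [Field K] (lam mu : YoungDiagram) : MvPowerSeries ℕ K :=
  tableauSeries K (fun _ => False) lam mu

/-- The Schur function `S_lam`, as a symmetric function in `x_0, x_1, …`. -/
def schur (K : Type*) [Field K] (lam : YoungDiagram) : MvPowerSeries ℕ K :=
  skewSchur K lam ⊥

/-- `S_lam` counts Mathlib's semistandard Young tableaux. -/
theorem coeff_schur (K : Type*) [Field K] (lam : YoungDiagram) (d : ℕ →₀ ℕ) :
    MvPowerSeries.coeff d (schur K lam) =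
      (Nat.card {T : SemistandardYoungTableau lam //
        ∑ c ∈ lam.cells, Finsupp.single (T c.1 c.2) 1 = d} : K) := by
  have hmem : ∀ {c : ℕ × ℕ}, c ∈ lam.cells \ (⊥ : YoungDiagram).cells ↔ c ∈ lam := by simp
  change ((Nat.card _ : ℕ) : K) = _
  congr 1
  refine Nat.card_congr (Equiv.symm ?_)
  have hcont : ∀ F : ℕ × ℕ → ℕ,
      content (fun c : ↥(lam.cells \ (⊥ : YoungDiagram).cells) => F c.1) =
        ∑ c ∈ lam.cells, Finsupp.single (F c) 1 := fun F => by
    rw [content, Finset.sum_coe_sort _ (fun c => Finsupp.single (F c) 1)]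
    simp
  refine
    { toFun := fun T => ⟨fun c => T.1 c.1.1 c.1.2, ⟨?_, ?_, ?_, ?_⟩, ?_⟩
      invFun := fun T => ⟨⟨fun i j => if h : (i, j) ∈ lam then T.1 ⟨(i, j), hmem.2 h⟩ else 0,
        ?_, ?_, ?_⟩, ?_⟩
      left_inv := ?_
      right_inv := ?_ }
  · rintro ⟨⟨i, j⟩, hc⟩ ⟨⟨i', j'⟩, hc'⟩ h1 h2
    obtain rfl : i = i' := h1
    exact T.1.row_weak h2 (hmem.1 hc')
  · rintro ⟨⟨i, j⟩, hc⟩ ⟨⟨i', j'⟩, hc'⟩ h1 h2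
    obtain rfl : j = j' := h1
    exact (T.1.col_strict h2 (hmem.1 hc')).le
  · exact fun _ _ _ _ h => h.elim
  · rintro ⟨⟨i, j⟩, hc⟩ ⟨⟨i', j'⟩, hc'⟩ h1 h2 _
    obtain rfl : j = j' := h1
    exact (T.1.col_strict h2 (hmem.1 hc')).ne
  · exact (hcont fun c => T.1 c.1 c.2).trans T.2
  · intro i j1 j2 hj hc
    have hc' := lam.up_left_mem le_rfl hj.le hc
    simp only [hc, hc', dif_pos]
    exact T.2.1.row_weak _ _ rfl hj
  · intro i1 i2 j hi hc
    have hc' := lam.up_left_mem hi.le le_rfl hc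
    simp only [hc, hc', dif_pos]
    exact lt_of_le_of_ne (T.2.1.col_weak _ _ rfl hi) (T.2.1.col_unprimed _ _ rfl hi id)
  · intro i j hc
    simp only [hc, dif_neg, not_false_eq_true]
  · refine (hcont _).symm.trans (Eq.trans ?_ T.2.2)
    congr 1
    funext c
    exact dif_pos (hmem.1 c.2)
  · intro T
    ext i j
    by_cases h : (i, j) ∈ lam
    · exact dif_pos h
    · exact (dif_neg h).trans (T.1.zeros h).symm
  · intro T
    ext c
    exact dif_pos (hmem.1 c.2)

/-- The Schur polynomial `S_lam(x_1, …, x_k, y_1, …, y_l)` in `k + l` variables. -/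
def schurFin (K : Type*) [Field K] (k l : ℕ) (lam : YoungDiagram) :
    MvPowerSeries (Fin k ⊕ₗ Fin l) K :=
  tableauSeries K (fun _ => False) lam ⊥

/-- The hook Schur function `HS_lam(x_1, …, x_k; y_1, …, y_l)`: the alphabet is
`1 < ⋯ < k < 1' < ⋯ < l'`, and the last `l` letters are primed. -/
def hookSchur (K : Type*) [Field K] (k l : ℕ) (lam : YoungDiagram) :
    MvPowerSeries (Fin k ⊕ₗ Fin l) K :=
  tableauSeries K (fun a => (ofLex a).isRight = true) lam ⊥

/-- The space of doubly symmetric functions: those symmetric functions `∑ m_lam S_lam` (finite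
sums) for which `∑ m_lam S_lam(X, Y) = ∑ m_lam HS_lam(X; Y)` for all finite, possibly empty, sets
of variables `X` and `Y`. -/
def doublySymmetric (K : Type*) [Field K] : Submodule K (MvPowerSeries ℕ K) where
  carrier := {f | f ∈ symmetricFunctions K ∧ ∃ m : YoungDiagram →₀ K,
    f = Finsupp.linearCombination K (schur K) m ∧
    ∀ k l : ℕ, Finsupp.linearCombination K (schurFin K k l) m =
      Finsupp.linearCombination K (hookSchur K k l) m}
  zero_mem' := ⟨zero_mem _, 0, by simp, by simp⟩
  add_mem' := by
    rintro f g ⟨hf, m, rfl, hm⟩ ⟨hg, n, rfl, hn⟩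
    exact ⟨add_mem hf hg, m + n, by rw [map_add], fun k l => by rw [map_add, map_add, hm, hn]⟩
  smul_mem' := by
    rintro c f ⟨hf, m, rfl, hm⟩
    exact ⟨Subalgebra.smul_mem _ hf c, c • m, by rw [map_smul],
      fun k l => by rw [map_smul, map_smul, hm]⟩

open Classical in
/-- The power sum `p_n = ∑_i x_i ^ n` (for `n ≥ 1`). -/
def powerSum (K : Type*) [Field K] (n : ℕ) : MvPowerSeries ℕ K :=
  fun d => if ∃ i : ℕ, d = Finsupp.single i n then 1 else 0

/-- `p_lam = p_{lam_1} p_{lam_2} ⋯`, the product over the parts of `lam`. -/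
def powerSumPart (K : Type*) [Field K] (lam : YoungDiagram) : MvPowerSeries ℕ K :=
  (lam.rowLens.map (powerSum K)).prod

/-- A partition is odd if all its parts are odd. -/
def IsOddPartition (lam : YoungDiagram) : Prop :=
  ∀ r ∈ lam.rowLens, Odd r

theorem finite_Iic (lam : YoungDiagram) : (Set.Iic lam).Finite := by
  refine Set.Finite.of_finite_image (f := YoungDiagram.cells)
    ((lam.cells.powerset.finite_toSet).subset ?_) ?_
  · rintro _ ⟨mu, hmu, rfl⟩
    exact Finset.mem_coe.2 (Finset.mem_powerset.2 (YoungDiagram.cells_subset_iff.2 hmu))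
  · intro a _ b _ h
    exact YoungDiagram.ext h

/-- The doubly Schur function `DS_lam = ∑_{mu ⊆ lam} S_mu S_{(lam/mu)'}`, where `(lam/mu)'` is the
skew shape `lam'/mu'`, the prime denoting the conjugate partition. -/
def doublySchur (K : Type*) [Field K] (lam : YoungDiagram) : MvPowerSeries ℕ K :=
  ∑ mu ∈ (finite_Iic lam).toFinset, schur K mu * skewSchur K lam.transpose mu.transpose

/-- The hook partition `(a, 1^b)`. -/
def hookShape (a b : ℕ) (ha : 1 ≤ a) : YoungDiagram :=
  YoungDiagram.ofRowLens (a :: List.replicate b 1) (by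
    rw [List.sortedGE_iff_pairwise, List.pairwise_cons]
    refine ⟨fun x hx => ?_, List.pairwise_replicate.2 (Or.inr le_rfl)⟩
    rw [List.eq_of_mem_replicate hx]
    exact ha)

/-- `k_n = ∑_{a+b=n} S_{(a,1^b)}`, the sum over all `a ≥ 1` and `b ≥ 0` with `a + b = n`. -/
def hookSum (K : Type*) [Field K] (n : ℕ) : MvPowerSeries ℕ K :=
  ∑ p ∈ Finset.HasAntidiagonal.antidiagonal n, if h : 1 ≤ p.1 then schur K (hookShape p.1 p.2 h) else 0

end DoublySym

end

/-!
Write `P` for the polynomial ring in variables standing for the power sums `p_1, p_2, …`. In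
characteristic zero the complete symmetric functions are polynomials in the power sums
(`complete`, by Newton's identities). Call a family indexed by diagrams a Schur family for given
values of the power sums if it satisfies Pieri's rule (`IsSchurFamily`). Pieri's rule determines such
a family from its complete symmetric functions, so there is one element `Q_lam` of `P`, the same for
all Schur families, whose value on the power sums is the member with index `lam`
(`exists_schurPoly`); conversely every element of `P` is a combination of the `Q_lam` in every
Schur family, with coefficients that depend on that element only (`exists_schur_expansion`).

The generating functions of tableaux in an alphabet with unprimed and primed letters form a Schur
family whose power sums are `∑ x ^ n + (-1) ^ (n - 1) ∑ y ^ n`. To see this, letters are adjoined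
one at a time (`tabSum_insert`): an unprimed letter adds a horizontal strip to the shape, and a
primed letter adds a vertical strip. Pieri's rule survives an unprimed letter by a local growth
bijection (`pieriSum_addLetter_false`), and a primed letter because adjoining it is inverse to
adjoining an unprimed letter of the opposite weight (`addLetter_true_addLetter_false_neg`).
Identities in infinitely many variables are checked after setting all but finitely many variables
to zero (`truncate`). Thus `S_lam`, `S_lam(X, Y)`, `HS_lam(X; Y)` and `DS_lam` are the values of the
same `Q_lam` under `p_n ↦ p_n`, `p_n ↦ p_n(X) + p_n(Y)`, `p_n ↦ p_n(X) + (-1) ^ (n - 1) p_n(Y)` and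
`p_n ↦ (1 + (-1) ^ (n - 1)) p_n` respectively.

A doubly symmetric function is therefore an element `F` of `P` on which the second and the third
substitution agree. Over an algebraically closed field finitely many power sums of `X` and of `Y`
take arbitrary values (`exists_powerSum_eq`), so the `p_n` are algebraically independent
(`evalPowerSums_injective`), and choosing the even power sums of `X` and `Y` equal and the odd ones
of `Y` zero shows that `F` involves only odd power sums (`mem_supported_of_aeval_eq`). This gives the
algebra generators `p_n` and the basis `p_lam`. The fourth substitution maps `P` onto the
polynomials in the odd power sums, so the images `DS_lam` of the `Q_lam` span this space and the
images of the complete symmetric functions generate it; by Pieri's rule for columns the latter are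
twice the hook sums `k_n` (`aeval_doubledPowerSum_complete`).
-/

noncomputable section

namespace DoublySym

open scoped Classical

universe u

/-! ### Young diagrams through their row lengths -/

theorem ext_rowLen {lam mu : YoungDiagram} (h : ∀ i, lam.rowLen i = mu.rowLen i) : lam = mu := by
  ext ⟨i, j⟩
  simp only [YoungDiagram.mem_cells, YoungDiagram.mem_iff_lt_rowLen, h]

theorem rowLen_eq_zero {lam : YoungDiagram} {i : ℕ} (h : lam.colLen 0 ≤ i) : lam.rowLen i = 0 := by
  by_contra h0
  have : (i, 0) ∈ lam := YoungDiagram.mem_iff_lt_rowLen.2 (Nat.pos_of_ne_zero h0)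
  rw [YoungDiagram.mem_iff_lt_colLen] at this
  omega

theorem card_eq_sum_rowLen (lam : YoungDiagram) {N : ℕ} (hN : lam.colLen 0 ≤ N) :
    lam.card = ∑ i ∈ Finset.range N, lam.rowLen i := by
  rw [YoungDiagram.card, Finset.card_eq_sum_card_fiberwise (f := Prod.fst) (t := Finset.range N)]
  · exact Finset.sum_congr rfl fun i _ => (YoungDiagram.rowLen_eq_card lam).symm
  · rintro ⟨i, j⟩ h
    simp only [Finset.mem_coe, YoungDiagram.mem_cells, Finset.coe_range, Set.mem_Iio] at h ⊢
    have := YoungDiagram.mem_iff_lt_colLen.1 (lam.up_left_mem le_rfl (Nat.zero_le j) h)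
    omega

theorem isLowerSet_rowFun {f : ℕ → ℕ} (hf : Antitone f) (N : ℕ) :
    IsLowerSet (((Finset.range N ×ˢ Finset.range (f 0)).filter fun c => c.2 < f c.1 :
      Finset (ℕ × ℕ)) : Set (ℕ × ℕ)) := by
  rintro ⟨i, j⟩ ⟨i', j'⟩ ⟨hi, hj⟩ hc
  simp only [Finset.coe_filter, Finset.mem_product, Finset.mem_range, Set.mem_ofPred_eq]
    at hc ⊢ hi hj
  have := hf hi
  omega

/-- The Young diagram whose row lengths are the values of `f`; the empty diagram if `f` is not
the sequence of row lengths of a diagram. -/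
def ofRowFun (f : ℕ → ℕ) : YoungDiagram :=
  if h : Antitone f ∧ ∃ N, f N = 0 then ⟨_, isLowerSet_rowFun h.1 h.2.choose⟩ else ⊥

theorem rowLen_ofRowFun {f : ℕ → ℕ} (hf : Antitone f) {N : ℕ} (hN : f N = 0) (i : ℕ) :
    (ofRowFun f).rowLen i = f i := by
  have h : Antitone f ∧ ∃ N, f N = 0 := ⟨hf, N, hN⟩
  have hmem : ∀ j, (i, j) ∈ ofRowFun f ↔ j < f i := fun j => by
    rw [ofRowFun, dif_pos h]
    simp only [YoungDiagram.mem_mk, Finset.mem_filter, Finset.mem_product, Finset.mem_range]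
    refine ⟨fun h => h.2, fun hj => ⟨⟨?_, hj.trans_le (hf (Nat.zero_le i))⟩, hj⟩⟩
    by_contra hi
    have := hf (not_lt.1 hi)
    rw [h.2.choose_spec] at this
    omega
  have h2 : ∀ j, j < (ofRowFun f).rowLen i ↔ j < f i := fun j => by
    rw [← YoungDiagram.mem_iff_lt_rowLen, hmem]
  have h3 := h2 (f i)
  have h4 := h2 ((ofRowFun f).rowLen i)
  omega

theorem finite_card_eq (n : ℕ) : {lam : YoungDiagram | lam.card = n}.Finite := by
  refine Set.Finite.of_finite_image (f := YoungDiagram.cells)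
    ((((Finset.range n) ×ˢ (Finset.range n)).powerset.finite_toSet).subset ?_)
    fun a _ b _ h => YoungDiagram.ext h
  rintro _ ⟨lam, hlam, rfl⟩
  simp only [Finset.coe_powerset, Set.mem_preimage, Set.mem_powerset_iff, Finset.coe_subset]
  rintro ⟨i, j⟩ h
  have h1 := YoungDiagram.mem_iff_lt_rowLen.1 h
  have h2 := YoungDiagram.mem_iff_lt_colLen.1 h
  rw [YoungDiagram.rowLen_eq_card] at h1
  rw [YoungDiagram.colLen_eq_card] at h2
  have h3 : (lam.row i).card ≤ lam.card := Finset.card_le_card (Finset.filter_subset _ _)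
  have h4 : (lam.col j).card ≤ lam.card := Finset.card_le_card (Finset.filter_subset _ _)
  have h5 : lam.card = n := hlam
  simp only [Finset.mem_product, Finset.mem_range]
  omega

/-! ### Horizontal and vertical strips -/

/-- `lam/mu` is a strip: the cells that one letter may occupy in a tableau. For an unprimed letter
(`b` false) this is a horizontal strip, with no two cells in a column; for a primed letter
(`b` true) it is a vertical strip, with no two cells in a row. -/
structure IsStrip (b : Prop) (mu lam : YoungDiagram) : Prop where
  le : mu ≤ lam
  horizontal : ¬ b → ∀ i j, (i + 1, j) ∈ lam → (i, j) ∈ mu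
  vertical : b → ∀ i j, (i, j + 1) ∈ lam → (i, j) ∈ mu

theorem le_iff_rowLen {mu lam : YoungDiagram} :
    mu ≤ lam ↔ ∀ i, mu.rowLen i ≤ lam.rowLen i := by
  constructor
  · intro h i
    by_contra hlt
    have h1 : (i, lam.rowLen i) ∈ mu := YoungDiagram.mem_iff_lt_rowLen.2 (not_le.1 hlt)
    have h2 := YoungDiagram.mem_iff_lt_rowLen.1 (h h1)
    omega
  · rintro h ⟨i, j⟩ hc
    exact YoungDiagram.mem_iff_lt_rowLen.2
      ((YoungDiagram.mem_iff_lt_rowLen.1 hc).trans_le (h i))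

theorem isStrip_false_iff {mu lam : YoungDiagram} :
    IsStrip False mu lam ↔
      ∀ i, mu.rowLen i ≤ lam.rowLen i ∧ lam.rowLen (i + 1) ≤ mu.rowLen i := by
  constructor
  · intro h i
    refine ⟨le_iff_rowLen.1 h.le i, ?_⟩
    by_contra hlt
    have h1 := h.horizontal id i (mu.rowLen i) (YoungDiagram.mem_iff_lt_rowLen.2 (not_le.1 hlt))
    rw [YoungDiagram.mem_iff_lt_rowLen] at h1
    omega
  · intro h
    refine ⟨le_iff_rowLen.2 fun i => (h i).1, fun _ i j hc => ?_, fun h => h.elim⟩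
    rw [YoungDiagram.mem_iff_lt_rowLen] at hc ⊢
    exact hc.trans_le (h i).2

theorem isStrip_true_iff {mu lam : YoungDiagram} :
    IsStrip True mu lam ↔
      ∀ i, mu.rowLen i ≤ lam.rowLen i ∧ lam.rowLen i ≤ mu.rowLen i + 1 := by
  constructor
  · intro h i
    refine ⟨le_iff_rowLen.1 h.le i, ?_⟩
    by_contra hlt
    have h1 := h.vertical trivial i (mu.rowLen i)
      (YoungDiagram.mem_iff_lt_rowLen.2 (not_le.1 hlt))
    rw [YoungDiagram.mem_iff_lt_rowLen] at h1
    omega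
  · intro h
    refine ⟨le_iff_rowLen.2 fun i => (h i).1, fun h => (h trivial).elim, fun _ i j hc => ?_⟩
    rw [YoungDiagram.mem_iff_lt_rowLen] at hc ⊢
    have := (h i).2
    omega

theorem IsStrip.card_le {b : Prop} {mu lam : YoungDiagram} (h : IsStrip b mu lam) :
    mu.card ≤ lam.card :=
  Finset.card_le_card h.le

theorem isStrip_refl (b : Prop) (lam : YoungDiagram) : IsStrip b lam lam :=
  ⟨le_rfl, fun _ i _ h => lam.up_left_mem (Nat.le_succ i) le_rfl h,
    fun _ _ j h => lam.up_left_mem le_rfl (Nat.le_succ j) h⟩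

/-! ### The local growth bijection -/

/-- The reflection of `v` in the interval
`[max (mu_{i+1}, kap_{i+1}), min (mu_i, kap_i)]`. -/
def reflectRow (mu kap : YoungDiagram) (i v : ℕ) : ℕ :=
  max (mu.rowLen (i + 1)) (kap.rowLen (i + 1)) + min (mu.rowLen i) (kap.rowLen i) - v

/-- The lower corner of the growth square with upper corner `lam`. -/
def growthDown (mu kap lam : YoungDiagram) : YoungDiagram :=
  ofRowFun fun i => reflectRow mu kap i (lam.rowLen (i + 1))

/-- The amount by which the first row of `lam` exceeds the first rows of `mu` and `kap`. -/
def growthExcess (mu kap lam : YoungDiagram) : ℕ :=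
  lam.rowLen 0 - max (mu.rowLen 0) (kap.rowLen 0)

/-- The upper corner of the growth square with lower corner `rho` and first row excess `k`. -/
def growthUp (mu kap : YoungDiagram) (k : ℕ) (rho : YoungDiagram) : YoungDiagram :=
  ofRowFun fun
    | 0 => max (mu.rowLen 0) (kap.rowLen 0) + k
    | i + 1 => reflectRow mu kap i (rho.rowLen i)

section Growth

variable {mu kap lam rho : YoungDiagram} {k : ℕ}

theorem rowLen_growthDown (h1 : IsStrip False mu lam) (h2 : IsStrip False kap lam) (i : ℕ) :
    (growthDown mu kap lam).rowLen i = reflectRow mu kap i (lam.rowLen (i + 1)) := by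
  rw [isStrip_false_iff] at h1 h2
  refine rowLen_ofRowFun (N := mu.colLen 0)
    (f := fun i => reflectRow mu kap i (lam.rowLen (i + 1)))
    (antitone_nat_of_succ_le fun n => ?_) ?_ i
  · have a1 := h1 n
    have a2 := h1 (n + 1)
    have a3 := h2 n
    have a4 := h2 (n + 1)
    have a5 := h1 (n + 1 + 1)
    have a6 := h2 (n + 1 + 1)
    simp only [reflectRow]
    omega
  · have a1 := h1 (mu.colLen 0)
    have a2 := h1 (mu.colLen 0 + 1)
    have a3 := h2 (mu.colLen 0)
    have a4 := h2 (mu.colLen 0 + 1)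
    have a5 := rowLen_eq_zero (le_refl (mu.colLen 0))
    simp only [reflectRow]
    omega

theorem rowLen_growthUp_zero (h1 : IsStrip False rho mu) (h2 : IsStrip False rho kap) :
    (growthUp mu kap k rho).rowLen 0 = max (mu.rowLen 0) (kap.rowLen 0) + k ∧
      ∀ i, (growthUp mu kap k rho).rowLen (i + 1) = reflectRow mu kap i (rho.rowLen i) := by
  rw [isStrip_false_iff] at h1 h2
  have key := rowLen_ofRowFun (N := mu.colLen 0 + 1) (f := fun
    | 0 => max (mu.rowLen 0) (kap.rowLen 0) + k
    | i + 1 => reflectRow mu kap i (rho.rowLen i)) (antitone_nat_of_succ_le fun n => ?_) ?_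
  · exact ⟨key 0, fun i => key (i + 1)⟩
  · have a1 := h1 n
    have a3 := h2 n
    cases n with
    | zero => simp only [reflectRow]; omega
    | succ n =>
      have a2 := h1 n
      have a4 := h2 n
      simp only [reflectRow]
      omega
  · have a1 := h1 (mu.colLen 0)
    have a3 := h2 (mu.colLen 0)
    have a5 := rowLen_eq_zero (le_refl (mu.colLen 0))
    simp only [reflectRow]
    omega

theorem growthDown_isStrip_left (h1 : IsStrip False mu lam) (h2 : IsStrip False kap lam) :
    IsStrip False (growthDown mu kap lam) mu := by
  rw [isStrip_false_iff]
  intro i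
  rw [rowLen_growthDown h1 h2]
  rw [isStrip_false_iff] at h1 h2
  have a1 := h1 i
  have a2 := h1 (i + 1)
  have a3 := h2 i
  have a4 := h2 (i + 1)
  simp only [reflectRow]
  omega

theorem growthDown_isStrip_right (h1 : IsStrip False mu lam) (h2 : IsStrip False kap lam) :
    IsStrip False (growthDown mu kap lam) kap := by
  rw [isStrip_false_iff]
  intro i
  rw [rowLen_growthDown h1 h2]
  rw [isStrip_false_iff] at h1 h2
  have a1 := h1 i
  have a2 := h1 (i + 1)
  have a3 := h2 i
  have a4 := h2 (i + 1)
  simp only [reflectRow]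
  omega

theorem growthUp_isStrip_left (h1 : IsStrip False rho mu) (h2 : IsStrip False rho kap) :
    IsStrip False mu (growthUp mu kap k rho) := by
  obtain ⟨h0, hs⟩ := rowLen_growthUp_zero (k := k) h1 h2
  rw [isStrip_false_iff] at h1 h2 ⊢
  intro i
  have a1 := h1 i
  have a3 := h2 i
  rw [hs]
  cases i with
  | zero => rw [h0]; simp only [reflectRow]; omega
  | succ i =>
    have a2 := h1 i
    have a4 := h2 i
    rw [hs]
    simp only [reflectRow]
    omega

theorem growthUp_isStrip_right (h1 : IsStrip False rho mu) (h2 : IsStrip False rho kap) :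
    IsStrip False kap (growthUp mu kap k rho) := by
  obtain ⟨h0, hs⟩ := rowLen_growthUp_zero (k := k) h1 h2
  rw [isStrip_false_iff] at h1 h2 ⊢
  intro i
  have a1 := h1 i
  have a3 := h2 i
  rw [hs]
  cases i with
  | zero => rw [h0]; simp only [reflectRow]; omega
  | succ i =>
    have a2 := h1 i
    have a4 := h2 i
    rw [hs]
    simp only [reflectRow]
    omega

theorem growthUp_growthDown (h1 : IsStrip False mu lam) (h2 : IsStrip False kap lam) :
    growthUp mu kap (growthExcess mu kap lam) (growthDown mu kap lam) = lam := by
  obtain ⟨h0, hs⟩ := rowLen_growthUp_zero (k := growthExcess mu kap lam)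
    (growthDown_isStrip_left h1 h2) (growthDown_isStrip_right h1 h2)
  refine ext_rowLen fun i => ?_
  cases i with
  | zero =>
    rw [isStrip_false_iff] at h1 h2
    have a1 := h1 0
    have a2 := h2 0
    rw [h0, growthExcess]
    omega
  | succ i =>
    rw [hs, rowLen_growthDown h1 h2]
    rw [isStrip_false_iff] at h1 h2
    have a1 := h1 i
    have a2 := h1 (i + 1)
    have a3 := h2 i
    have a4 := h2 (i + 1)
    simp only [reflectRow]
    omega

theorem growthDown_growthUp (h1 : IsStrip False rho mu) (h2 : IsStrip False rho kap) :
    growthDown mu kap (growthUp mu kap k rho) = rho := by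
  obtain ⟨h0, hs⟩ := rowLen_growthUp_zero (k := k) h1 h2
  refine ext_rowLen fun i => ?_
  rw [rowLen_growthDown (growthUp_isStrip_left h1 h2) (growthUp_isStrip_right h1 h2), hs]
  rw [isStrip_false_iff] at h1 h2
  have a1 := h1 i
  have a3 := h2 i
  simp only [reflectRow]
  omega

theorem growthExcess_growthUp (h1 : IsStrip False rho mu) (h2 : IsStrip False rho kap) :
    growthExcess mu kap (growthUp mu kap k rho) = k := by
  rw [growthExcess, (rowLen_growthUp_zero h1 h2).1, Nat.add_sub_cancel_left]

theorem card_growthDown (h1 : IsStrip False mu lam) (h2 : IsStrip False kap lam) :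
    lam.card + (growthDown mu kap lam).card =
      growthExcess mu kap lam + mu.card + kap.card := by
  have hd := rowLen_growthDown h1 h2
  rw [isStrip_false_iff] at h1 h2
  obtain ⟨N, hN⟩ : ∃ N, N = max (max (mu.colLen 0) (kap.colLen 0))
    (max (lam.colLen 0) ((growthDown mu kap lam).colLen 0)) := ⟨_, rfl⟩
  rw [card_eq_sum_rowLen lam (N := N + 1) (by omega),
    card_eq_sum_rowLen (growthDown mu kap lam) (N := N) (by omega),
    card_eq_sum_rowLen mu (N := N) (by omega), card_eq_sum_rowLen kap (N := N) (by omega),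
    Finset.sum_range_succ', add_right_comm, ← Finset.sum_add_distrib, add_assoc (growthExcess _ _ _),
    ← Finset.sum_add_distrib]
  have e1 : ∀ i ∈ Finset.range N, lam.rowLen (i + 1) + (growthDown mu kap lam).rowLen i =
      max (mu.rowLen (i + 1)) (kap.rowLen (i + 1)) + min (mu.rowLen i) (kap.rowLen i) := by
    intro i _
    have a1 := h1 i
    have a2 := h1 (i + 1)
    have a3 := h2 i
    have a4 := h2 (i + 1)
    rw [hd, reflectRow]
    omega
  have e2 : ∀ i ∈ Finset.range N, mu.rowLen i + kap.rowLen i =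
      max (mu.rowLen i) (kap.rowLen i) + min (mu.rowLen i) (kap.rowLen i) := by
    intro i _
    omega
  rw [Finset.sum_congr rfl e1, Finset.sum_congr rfl e2, Finset.sum_add_distrib,
    Finset.sum_add_distrib]
  have e3 := Finset.sum_range_succ (fun i => max (mu.rowLen i) (kap.rowLen i)) N
  rw [Finset.sum_range_succ'] at e3
  have e4 := rowLen_eq_zero (lam := mu) (i := N) (by omega)
  have e5 := rowLen_eq_zero (lam := kap) (i := N) (by omega)
  have a1 := h1 0
  have a3 := h2 0
  rw [growthExcess]
  omega

end Growth

/-! ### Strip operators -/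

section Operators

variable {R : Type*} [CommRing R]

/-- The diagrams `mu` such that `lam/mu` is a strip. -/
def stripsBelow (b : Prop) (lam : YoungDiagram) : Finset YoungDiagram :=
  (finite_Iic lam).toFinset.filter fun mu => IsStrip b mu lam

theorem mem_stripsBelow {b : Prop} {mu lam : YoungDiagram} :
    mu ∈ stripsBelow b lam ↔ IsStrip b mu lam := by
  simp only [stripsBelow, Finset.mem_filter, Set.Finite.mem_toFinset, Set.mem_Iic,
    and_iff_right_iff_imp]
  exact fun h => h.le

/-- The diagrams `lam` such that `lam/mu` is a horizontal strip of size `n`. -/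
def stripsAbove (n : ℕ) (mu : YoungDiagram) : Finset YoungDiagram :=
  (finite_card_eq (mu.card + n)).toFinset.filter fun lam => IsStrip False mu lam

theorem mem_stripsAbove {n : ℕ} {mu lam : YoungDiagram} :
    lam ∈ stripsAbove n mu ↔ IsStrip False mu lam ∧ lam.card = mu.card + n := by
  simp only [stripsAbove, Finset.mem_filter, Set.Finite.mem_toFinset, Set.mem_ofPred_eq, and_comm]

/-- The effect on a family indexed by diagrams of adjoining one letter of weight `x`, primed if
`b` holds, to the alphabet. -/
def addLetter (b : Prop) (x : R) (F : YoungDiagram → R) (lam : YoungDiagram) : R :=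
  ∑ mu ∈ stripsBelow b lam, x ^ (lam.card - mu.card) * F mu

/-- The sum of a family over all ways to add a horizontal strip of size `n`: the right hand side
of Pieri's rule. -/
def pieriSum (n : ℕ) (F : YoungDiagram → R) (mu : YoungDiagram) : R :=
  ∑ lam ∈ stripsAbove n mu, F lam

/-- Adding a horizontal strip commutes with adjoining an unprimed letter up to a geometric
series in its weight. -/
theorem pieriSum_addLetter_false (n : ℕ) (x : R) (F : YoungDiagram → R) (mu : YoungDiagram) :
    pieriSum n (addLetter False x F) mu =
      ∑ k ∈ Finset.range (n + 1), x ^ k * addLetter False x (pieriSum (n - k) F) mu := by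
  simp only [pieriSum, addLetter, Finset.mul_sum]
  rw [Finset.sum_sigma', Finset.sum_congr rfl fun k _ => Finset.sum_sigma' _ _ _,
    Finset.sum_sigma']
  refine Finset.sum_bij' (fun p _ => ⟨growthExcess mu p.2 p.1, growthDown mu p.2 p.1, p.2⟩)
    (fun q _ => ⟨growthUp mu q.2.2 q.1 q.2.1, q.2.2⟩) ?_ ?_ ?_ ?_ ?_
  · rintro ⟨lam, kap⟩ hp
    simp only [Finset.mem_sigma, mem_stripsAbove, mem_stripsBelow, Finset.mem_range] at hp ⊢
    have hc := card_growthDown hp.1.1 hp.2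
    have hr := growthDown_isStrip_right hp.1.1 hp.2
    have := hr.card_le
    exact ⟨by omega, growthDown_isStrip_left hp.1.1 hp.2, hr, by omega⟩
  · rintro ⟨k, rho, kap⟩ hq
    simp only [Finset.mem_sigma, mem_stripsAbove, mem_stripsBelow, Finset.mem_range] at hq ⊢
    obtain ⟨hk, h1, h2, hcard⟩ := hq
    have hl := growthUp_isStrip_left (k := k) h1 h2
    have hr := growthUp_isStrip_right (k := k) h1 h2
    have hc := card_growthDown hl hr
    rw [growthDown_growthUp h1 h2, growthExcess_growthUp h1 h2] at hc
    exact ⟨⟨hl, by omega⟩, hr⟩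
  · rintro ⟨lam, kap⟩ hp
    simp only [Finset.mem_sigma, mem_stripsAbove, mem_stripsBelow] at hp
    simp only [growthUp_growthDown hp.1.1 hp.2]
  · rintro ⟨k, rho, kap⟩ hq
    simp only [Finset.mem_sigma, mem_stripsAbove, mem_stripsBelow, Finset.mem_range] at hq
    simp only [growthDown_growthUp hq.2.1 hq.2.2.1, growthExcess_growthUp hq.2.1 hq.2.2.1]
  · rintro ⟨lam, kap⟩ hp
    simp only [Finset.mem_sigma, mem_stripsAbove, mem_stripsBelow] at hp ⊢
    have hc := card_growthDown hp.1.1 hp.2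
    have h1 := hp.2.card_le
    have h2 := (growthDown_isStrip_left hp.1.1 hp.2).card_le
    rw [← mul_assoc, ← pow_add]
    congr 2
    omega

end Operators

/-! ### Primed letters invert unprimed letters of opposite weight -/

/-- Switch the length of row `i` of `rho` between `lam_i` and `lam_i - 1`. -/
def toggleRow (lam : YoungDiagram) (i : ℕ) (rho : YoungDiagram) : YoungDiagram :=
  ofRowFun fun j => if j = i then 2 * lam.rowLen i - 1 - rho.rowLen i else rho.rowLen j

section Toggle

variable {mu rho lam : YoungDiagram} {i : ℕ}

theorem rowLen_toggleRow (hi : mu.rowLen i < lam.rowLen i)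
    (hlt : ∀ j < i, lam.rowLen j = mu.rowLen j) (h1 : IsStrip False mu rho)
    (h2 : IsStrip True rho lam) (j : ℕ) :
    (toggleRow lam i rho).rowLen j =
      if j = i then 2 * lam.rowLen i - 1 - rho.rowLen i else rho.rowLen j := by
  rw [isStrip_false_iff] at h1
  rw [isStrip_true_iff] at h2
  refine rowLen_ofRowFun (N := max (i + 1) (rho.colLen 0))
    (f := fun j => if j = i then 2 * lam.rowLen i - 1 - rho.rowLen i else rho.rowLen j)
    (antitone_nat_of_succ_le fun n => ?_) ?_ j
  · have a1 := h1 n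
    have a3 := h1 (n + 1)
    have a5 := h2 (n + 1)
    have a6 := h2 i
    have a7 := hlt n
    have a8 := lam.rowLen_anti n (n + 1) (Nat.le_succ n)
    by_cases e1 : n + 1 = i
    · subst e1
      rw [if_pos rfl, if_neg (by omega)]
      omega
    · rw [if_neg e1]
      split_ifs with e2
      · subst e2
        omega
      · omega
  · rw [if_neg (by omega)]
    exact rowLen_eq_zero (by omega)

theorem isStrip_toggleRow_left (hi : mu.rowLen i < lam.rowLen i)
    (hlt : ∀ j < i, lam.rowLen j = mu.rowLen j) (h1 : IsStrip False mu rho)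
    (h2 : IsStrip True rho lam) : IsStrip False mu (toggleRow lam i rho) := by
  have key := rowLen_toggleRow hi hlt h1 h2
  rw [isStrip_false_iff] at h1 ⊢
  rw [isStrip_true_iff] at h2
  intro j
  have a1 := h1 j
  have a6 := h2 i
  rw [key, key]
  refine ⟨?_, ?_⟩
  · split_ifs with e
    · subst e; omega
    · omega
  · split_ifs with e
    · subst e
      have a7 := hlt j (by omega)
      have a8 := lam.rowLen_anti j (j + 1) (Nat.le_succ j)
      omega
    · omega

theorem isStrip_toggleRow_right (hi : mu.rowLen i < lam.rowLen i)
    (hlt : ∀ j < i, lam.rowLen j = mu.rowLen j) (h1 : IsStrip False mu rho)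
    (h2 : IsStrip True rho lam) : IsStrip True (toggleRow lam i rho) lam := by
  have key := rowLen_toggleRow hi hlt h1 h2
  rw [isStrip_true_iff] at h2 ⊢
  intro j
  have a1 := h2 j
  rw [key]
  split_ifs with e
  · subst e; omega
  · omega

theorem card_toggleRow (hi : mu.rowLen i < lam.rowLen i)
    (hlt : ∀ j < i, lam.rowLen j = mu.rowLen j) (h1 : IsStrip False mu rho)
    (h2 : IsStrip True rho lam) :
    (toggleRow lam i rho).card = rho.card + 1 ∨ rho.card = (toggleRow lam i rho).card + 1 := by
  have key := rowLen_toggleRow hi hlt h1 h2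
  obtain ⟨N, hN⟩ : ∃ N, N = max (i + 1)
    (max (rho.colLen 0) ((toggleRow lam i rho).colLen 0)) := ⟨_, rfl⟩
  have hiN : i ∈ Finset.range N := Finset.mem_range.2 (by omega)
  rw [card_eq_sum_rowLen rho (N := N) (by omega),
    card_eq_sum_rowLen (toggleRow lam i rho) (N := N) (by omega),
    ← Finset.add_sum_erase _ _ hiN, ← Finset.add_sum_erase _ rho.rowLen hiN]
  have e : ∑ j ∈ (Finset.range N).erase i, (toggleRow lam i rho).rowLen j =
      ∑ j ∈ (Finset.range N).erase i, rho.rowLen j :=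
    Finset.sum_congr rfl fun j hj => by rw [key, if_neg (Finset.ne_of_mem_erase hj)]
  have e2 := key i
  rw [if_pos rfl] at e2
  rw [isStrip_true_iff] at h2
  have a1 := h2 i
  rw [e, e2]
  omega

theorem toggleRow_toggleRow (hi : mu.rowLen i < lam.rowLen i)
    (hlt : ∀ j < i, lam.rowLen j = mu.rowLen j) (h1 : IsStrip False mu rho)
    (h2 : IsStrip True rho lam) : toggleRow lam i (toggleRow lam i rho) = rho := by
  have key := rowLen_toggleRow hi hlt h1 h2
  refine ext_rowLen fun j => ?_
  rw [rowLen_toggleRow hi hlt (isStrip_toggleRow_left hi hlt h1 h2)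
    (isStrip_toggleRow_right hi hlt h1 h2), key, key, if_pos rfl]
  rw [isStrip_true_iff] at h2
  have a1 := h2 i
  split_ifs with e
  · subst e; omega
  · rfl

end Toggle

section Operators

variable {R : Type*} [CommRing R]

theorem pow_mul_neg_pow_add_eq_zero (y : R) {L r r' m : ℕ} (hm : m ≤ r) (hL : r ≤ L) (hm' : m ≤ r')
    (hL' : r' ≤ L) (h : r' = r + 1 ∨ r = r' + 1) :
    y ^ (L - r) * (-y) ^ (r - m) + y ^ (L - r') * (-y) ^ (r' - m) = 0 := by
  obtain ⟨a, rfl⟩ := Nat.exists_eq_add_of_le hm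
  obtain ⟨a', rfl⟩ := Nat.exists_eq_add_of_le hm'
  obtain ⟨b, rfl⟩ := Nat.exists_eq_add_of_le hL
  obtain ⟨b', hb'⟩ := Nat.exists_eq_add_of_le hL'
  rw [show m + a + b - (m + a) = b by omega, show m + a + b - (m + a') = b' by omega,
    show m + a - m = a by omega, show m + a' - m = a' by omega]
  rcases h with h | h
  · obtain rfl : a' = a + 1 := by omega
    obtain rfl : b = b' + 1 := by omega
    ring
  · obtain rfl : a = a' + 1 := by omega
    obtain rfl : b' = b + 1 := by omega
    ring

theorem sum_between_strips_eq_zero (y : R) {mu lam : YoungDiagram} (hne : mu ≠ lam) :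
    ∑ rho ∈ (stripsBelow True lam).filter (fun rho => IsStrip False mu rho),
      y ^ (lam.card - rho.card) * (-y) ^ (rho.card - mu.card) = 0 := by
  by_cases hex : ∃ i, mu.rowLen i ≠ lam.rowLen i
  swap
  · push Not at hex
    exact absurd (ext_rowLen hex) hne
  by_cases hle : ∀ i, mu.rowLen i ≤ lam.rowLen i
  swap
  · refine Finset.sum_eq_zero fun rho hrho => ?_
    rw [Finset.mem_filter, mem_stripsBelow] at hrho
    exact absurd (le_iff_rowLen.1 (hrho.2.le.trans hrho.1.le)) hle
  -- the first row in which `mu` and `lam` differ can be switched freely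
  obtain ⟨i, hi, hlt⟩ : ∃ i, mu.rowLen i < lam.rowLen i ∧
      ∀ j < i, lam.rowLen j = mu.rowLen j :=
    ⟨Nat.find hex, lt_of_le_of_ne (hle _) (Nat.find_spec hex), fun j hj =>
      (not_not.1 (Nat.find_min hex hj)).symm⟩
  refine Finset.sum_involution (fun rho _ => toggleRow lam i rho) ?_ ?_ ?_ ?_
  · intro rho hrho
    rw [Finset.mem_filter, mem_stripsBelow] at hrho
    exact pow_mul_neg_pow_add_eq_zero y hrho.2.card_le hrho.1.card_le
      (isStrip_toggleRow_left hi hlt hrho.2 hrho.1).card_le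
      (isStrip_toggleRow_right hi hlt hrho.2 hrho.1).card_le
      (card_toggleRow hi hlt hrho.2 hrho.1)
  · intro rho hrho _ heq
    rw [Finset.mem_filter, mem_stripsBelow] at hrho
    have := card_toggleRow hi hlt hrho.2 hrho.1
    rw [heq] at this
    omega
  · intro rho hrho
    rw [Finset.mem_filter, mem_stripsBelow] at hrho ⊢
    exact ⟨isStrip_toggleRow_right hi hlt hrho.2 hrho.1,
      isStrip_toggleRow_left hi hlt hrho.2 hrho.1⟩
  · intro rho hrho
    rw [Finset.mem_filter, mem_stripsBelow] at hrho
    exact toggleRow_toggleRow hi hlt hrho.2 hrho.1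

/-- The coefficients of the composition are signed sums over the diagrams between `mu` and `lam`,
which cancel in pairs unless `mu = lam`. -/
theorem addLetter_true_addLetter_false_neg (y : R) (F : YoungDiagram → R) :
    addLetter True y (addLetter False (-y) F) = F := by
  funext lam
  simp only [addLetter, Finset.mul_sum]
  rw [Finset.sum_comm' (s' := fun mu => (stripsBelow True lam).filter fun rho => IsStrip False mu rho)
    (t' := (finite_Iic lam).toFinset)]
  · rw [Finset.sum_eq_single lam]
    · rw [Finset.sum_eq_single lam]
      · simp
      · intro rho hrho hne
        rw [Finset.mem_filter, mem_stripsBelow] at hrho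
        exact absurd (le_antisymm hrho.1.le hrho.2.le) hne
      · intro h
        exact absurd (Finset.mem_filter.2
          ⟨mem_stripsBelow.2 (isStrip_refl _ _), isStrip_refl _ _⟩) h
    · intro mu _ hne
      simp only [← mul_assoc]
      rw [← Finset.sum_mul, sum_between_strips_eq_zero y hne, zero_mul]
    · intro h
      simp at h
  · intro rho mu
    simp only [mem_stripsBelow, Finset.mem_filter, Set.Finite.mem_toFinset, Set.mem_Iic]
    exact ⟨fun h => ⟨h, h.2.le.trans h.1.le⟩, fun h => h.1⟩

theorem addLetter_eq_add (b : Prop) (x : R) (F : YoungDiagram → R) (lam : YoungDiagram) :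
    addLetter b x F lam =
      F lam + ∑ mu ∈ (stripsBelow b lam).erase lam, x ^ (lam.card - mu.card) * F mu := by
  rw [addLetter, ← Finset.add_sum_erase _ _ (mem_stripsBelow.2 (isStrip_refl b lam))]
  simp

theorem card_lt_of_mem_erase {b : Prop} {mu lam : YoungDiagram}
    (h : mu ∈ (stripsBelow b lam).erase lam) : mu.card < lam.card := by
  rw [Finset.mem_erase, mem_stripsBelow] at h
  exact Finset.card_lt_card (YoungDiagram.cells_ssubset_iff.2 (lt_of_le_of_ne h.2.le h.1))

theorem addLetter_injective (b : Prop) (x : R) :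
    Function.Injective (addLetter b x : (YoungDiagram → R) → YoungDiagram → R) := by
  intro F G h
  have key : ∀ n, ∀ lam : YoungDiagram, lam.card = n → F lam = G lam := by
    intro n
    induction n using Nat.strong_induction_on with
    | _ n ih =>
      intro lam hlam
      have h1 := congrFun h lam
      rw [addLetter_eq_add, addLetter_eq_add] at h1
      rw [Finset.sum_congr rfl fun mu hmu => by
        rw [ih mu.card (hlam ▸ card_lt_of_mem_erase hmu) mu rfl]] at h1
      exact add_right_cancel h1
  exact funext fun lam => key _ lam rfl

theorem addLetter_false_neg_addLetter_true (y : R) (F : YoungDiagram → R) :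
    addLetter False (-y) (addLetter True y F) = F :=
  addLetter_injective True y (addLetter_true_addLetter_false_neg y _)

theorem addLetter_add (b : Prop) (x : R) (F G : YoungDiagram → R) :
    addLetter b x (F + G) = addLetter b x F + addLetter b x G := by
  funext lam
  simp only [addLetter, Pi.add_apply, mul_add, Finset.sum_add_distrib]

theorem addLetter_smul (b : Prop) (x c : R) (F : YoungDiagram → R) :
    addLetter b x (c • F) = c • addLetter b x F := by
  funext lam
  simp only [addLetter, Pi.smul_apply, smul_eq_mul, Finset.mul_sum]
  exact Finset.sum_congr rfl fun mu _ => by ring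

theorem pieriSum_succ_addLetter_false (n : ℕ) (x : R) (F : YoungDiagram → R) :
    pieriSum (n + 1) (addLetter False x F) =
      addLetter False x (pieriSum (n + 1) F) + x • pieriSum n (addLetter False x F) := by
  funext mu
  rw [Pi.add_apply, Pi.smul_apply, pieriSum_addLetter_false, pieriSum_addLetter_false,
    Finset.sum_range_succ', smul_eq_mul, Finset.mul_sum, add_comm]
  simp only [pow_zero, one_mul, Nat.sub_zero, pow_succ', mul_assoc, Nat.add_sub_add_right]

/-- Adding a horizontal strip commutes with adjoining a primed letter up to a linear factor in
its weight. -/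
theorem pieriSum_succ_addLetter_true (n : ℕ) (y : R) (F : YoungDiagram → R) :
    pieriSum (n + 1) (addLetter True y F) =
      addLetter True y (pieriSum (n + 1) F) + y • addLetter True y (pieriSum n F) := by
  -- a primed letter of weight `y` inverts an unprimed letter of weight `-y`
  obtain ⟨G, rfl⟩ : ∃ G, F = addLetter False (-y) G :=
    ⟨_, (addLetter_false_neg_addLetter_true y F).symm⟩
  rw [addLetter_true_addLetter_false_neg, pieriSum_succ_addLetter_false, addLetter_add,
    addLetter_smul, addLetter_true_addLetter_false_neg, neg_smul, neg_add_cancel_right]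

theorem pieriSum_zero (F : YoungDiagram → R) : pieriSum 0 F = F := by
  funext mu
  rw [pieriSum, Finset.sum_eq_single mu]
  · intro lam hlam hne
    rw [mem_stripsAbove] at hlam
    exact absurd (YoungDiagram.ext (Finset.eq_of_subset_of_card_le hlam.1.le hlam.2.le)).symm hne
  · intro h
    exact absurd (mem_stripsAbove.2 ⟨isStrip_refl _ _, rfl⟩) h

/-! ### Pieri's rule -/

/-- The family `S`, indexed by diagrams, satisfies Pieri's rule, where the coefficients of `H` are
the complete symmetric functions. -/
def SatisfiesPieri (H : PowerSeries R) (S : YoungDiagram → R) : Prop :=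
  ∀ n, pieriSum n S = PowerSeries.coeff n H • S

/-- The generating function of the complete symmetric functions in a single letter. -/
def letterSeries (b : Prop) (x : R) : PowerSeries R :=
  if b then 1 + PowerSeries.C x * PowerSeries.X else PowerSeries.mk fun n => x ^ n

theorem SatisfiesPieri.addLetter {H : PowerSeries R} {S : YoungDiagram → R}
    (h : SatisfiesPieri H S) (b : Prop) (x : R) :
    SatisfiesPieri (letterSeries b x * H) (addLetter b x S) := by
  intro n
  by_cases hb : b
  · obtain rfl : b = True := eq_true hb
    rw [letterSeries, if_pos trivial]
    cases n with
    | zero =>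
      have h0 := h 0
      rw [pieriSum_zero] at h0
      rw [pieriSum_zero, add_mul, one_mul, mul_assoc, mul_comm PowerSeries.X, ← mul_assoc, map_add,
        PowerSeries.coeff_zero_mul_X, add_zero, ← addLetter_smul, ← h0]
    | succ n =>
      rw [pieriSum_succ_addLetter_true, h, h, addLetter_smul, addLetter_smul, add_mul, one_mul,
        mul_assoc, mul_comm PowerSeries.X, ← mul_assoc, map_add, PowerSeries.coeff_succ_mul_X,
        PowerSeries.coeff_C_mul, add_smul, mul_smul]
  · obtain rfl : b = False := eq_false hb
    rw [letterSeries, if_neg id]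
    funext mu
    rw [pieriSum_addLetter_false, PowerSeries.coeff_mul,
      Finset.Nat.sum_antidiagonal_eq_sum_range_succ_mk, Pi.smul_apply, smul_eq_mul, Finset.sum_mul]
    refine Finset.sum_congr rfl fun k _ => ?_
    rw [h, addLetter_smul, PowerSeries.coeff_mk, Pi.smul_apply, smul_eq_mul, mul_assoc]

end Operators

/-! ### Tableaux in a finite alphabet -/

section TableauSums

variable {R : Type*} [CommRing R] {A : Type*} [LinearOrder A]

/-- The sum of the weights of the semistandard tableaux of shape `lam/mu` with entries in the
finite set `t` of letters. -/
def tabSum (primed : A → Prop) (w : A → R) (t : Finset A) (lam mu : YoungDiagram) : R :=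
  ∑ T ∈ (Fintype.piFinset fun _ : ↥(lam.cells \ mu.cells) => t).filter (IsTableau primed),
    ∏ c, w (T c)

theorem IsTableau.mono {primed : A → Prop} {lam rho : YoungDiagram}
    {T : ↥(lam.cells \ rho.cells) → A} (h : IsTableau primed T)
    (c c' : ↥(lam.cells \ rho.cells)) (h1 : c.1.1 ≤ c'.1.1) (h2 : c.1.2 ≤ c'.1.2) :
    T c ≤ T c' := by
  obtain ⟨⟨i, j⟩, hc⟩ := c
  obtain ⟨⟨i', j'⟩, hc'⟩ := c'
  simp only at h1 h2
  have hm : (i', j) ∈ lam.cells \ rho.cells := by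
    simp only [Finset.mem_sdiff, YoungDiagram.mem_cells] at hc hc' ⊢
    exact ⟨lam.up_left_mem le_rfl h2 hc'.1, fun hr => hc.2 (rho.up_left_mem h1 le_rfl hr)⟩
  refine le_trans (b := T ⟨(i', j), hm⟩) ?_ ?_
  · rcases h1.eq_or_lt with rfl | h1
    · exact le_rfl
    · exact h.col_weak _ _ rfl h1
  · rcases h2.eq_or_lt with rfl | h2
    · exact le_rfl
    · exact h.row_weak _ _ rfl h2

theorem isLowerSet_shapeBelow {primed : A → Prop} {lam rho : YoungDiagram}
    {T : ↥(lam.cells \ rho.cells) → A} (h : IsTableau primed T) {a : A} (ha : ∀ c, T c ≤ a) :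
    IsLowerSet ((lam.cells.filter fun c => ∀ h : c ∈ lam.cells \ rho.cells, T ⟨c, h⟩ ≠ a :
      Finset (ℕ × ℕ)) : Set (ℕ × ℕ)) := by
  rintro ⟨i, j⟩ ⟨i', j'⟩ ⟨hi, hj⟩ hc
  simp only [Finset.coe_filter, YoungDiagram.mem_cells, Set.mem_ofPred_eq] at hc ⊢ hi hj
  refine ⟨lam.up_left_mem hi hj hc.1, fun h' heq => ?_⟩
  have h2 : (i, j) ∈ lam.cells \ rho.cells := by
    simp only [Finset.mem_sdiff, YoungDiagram.mem_cells] at h' ⊢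
    exact ⟨hc.1, fun hr => h'.2 (rho.up_left_mem hi hj hr)⟩
  have h3 := h.mono ⟨(i', j'), h'⟩ ⟨(i, j), h2⟩ hi hj
  rw [heq] at h3
  exact hc.2 h2 (le_antisymm (ha _) h3)

/-- The diagram consisting of `rho` and the cells of `lam/rho` in which the entry of the tableau
`T` is not the largest letter `a`. -/
def shapeBelow (a : A) {lam rho : YoungDiagram} (T : ↥(lam.cells \ rho.cells) → A) :
    YoungDiagram :=
  if h : IsLowerSet ((lam.cells.filter fun c => ∀ h : c ∈ lam.cells \ rho.cells, T ⟨c, h⟩ ≠ a :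
      Finset (ℕ × ℕ)) : Set (ℕ × ℕ)) then ⟨_, h⟩ else ⊥

theorem mem_shapeBelow {primed : A → Prop} {lam rho : YoungDiagram}
    {T : ↥(lam.cells \ rho.cells) → A} (h : IsTableau primed T) {a : A} (ha : ∀ c, T c ≤ a)
    {c : ℕ × ℕ} :
    c ∈ shapeBelow a T ↔ c ∈ lam ∧ ∀ h : c ∈ lam.cells \ rho.cells, T ⟨c, h⟩ ≠ a := by
  rw [shapeBelow, dif_pos (isLowerSet_shapeBelow h ha), YoungDiagram.mem_mk, Finset.mem_filter,
    YoungDiagram.mem_cells]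

theorem isStrip_shapeBelow {primed : A → Prop} {lam rho : YoungDiagram}
    {T : ↥(lam.cells \ rho.cells) → A} (h : IsTableau primed T) {a : A} (ha : ∀ c, T c ≤ a) :
    IsStrip (primed a) (shapeBelow a T) lam := by
  have hmem := fun c => mem_shapeBelow h ha (c := c)
  refine ⟨fun c hc => ((hmem c).1 hc).1, fun hb i j hc => ?_, fun hb i j hc => ?_⟩
  · refine (hmem _).2 ⟨lam.up_left_mem (Nat.le_succ i) le_rfl hc, fun h' heq => ?_⟩
    have h2 : (i + 1, j) ∈ lam.cells \ rho.cells := by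
      simp only [Finset.mem_sdiff, YoungDiagram.mem_cells] at h' ⊢
      exact ⟨hc, fun hr => h'.2 (rho.up_left_mem (Nat.le_succ i) le_rfl hr)⟩
    have h3 := h.col_weak ⟨_, h'⟩ ⟨_, h2⟩ rfl (Nat.lt_succ_self i)
    have h4 := h.col_unprimed ⟨_, h'⟩ ⟨_, h2⟩ rfl (Nat.lt_succ_self i) (heq ▸ hb)
    rw [heq] at h3 h4
    exact h4 (le_antisymm h3 (ha _))
  · refine (hmem _).2 ⟨lam.up_left_mem le_rfl (Nat.le_succ j) hc, fun h' heq => ?_⟩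
    have h2 : (i, j + 1) ∈ lam.cells \ rho.cells := by
      simp only [Finset.mem_sdiff, YoungDiagram.mem_cells] at h' ⊢
      exact ⟨hc, fun hr => h'.2 (rho.up_left_mem le_rfl (Nat.le_succ j) hr)⟩
    have h3 := h.row_weak ⟨_, h'⟩ ⟨_, h2⟩ rfl (Nat.lt_succ_self j)
    have h4 := h.row_primed ⟨_, h'⟩ ⟨_, h2⟩ rfl (Nat.lt_succ_self j) (heq ▸ hb)
    rw [heq] at h3 h4
    exact h4 (le_antisymm h3 (ha _))

/-- Extend a filling of `mu/rho` to `lam/rho` by the letter `a`. -/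
def extendFilling (a : A) {lam mu rho : YoungDiagram} (T : ↥(mu.cells \ rho.cells) → A)
    (c : ↥(lam.cells \ rho.cells)) : A :=
  if h : c.1 ∈ mu.cells \ rho.cells then T ⟨c.1, h⟩ else a

theorem isTableau_extendFilling {primed : A → Prop} {a : A} {lam mu rho : YoungDiagram}
    (hs : IsStrip (primed a) mu lam) {T : ↥(mu.cells \ rho.cells) → A} (hT : IsTableau primed T)
    (ha : ∀ c, T c < a) :
    IsTableau primed (extendFilling a T : ↥(lam.cells \ rho.cells) → A) := by
  have hlow : ∀ c c' : ↥(lam.cells \ rho.cells), c.1 ≤ c'.1 → c'.1 ∈ mu.cells \ rho.cells →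
      c.1 ∈ mu.cells \ rho.cells := fun c c' hle h => by
    have := c.2
    simp only [Finset.mem_sdiff, YoungDiagram.mem_cells] at h this ⊢
    exact ⟨mu.isLowerSet hle h.1, this.2⟩
  have hmu : ∀ c : ↥(lam.cells \ rho.cells), c.1 ∈ mu → c.1 ∈ mu.cells \ rho.cells :=
    fun c h => Finset.mem_sdiff.2 ⟨h, (Finset.mem_sdiff.1 c.2).2⟩
  have hlam : ∀ c : ↥(lam.cells \ rho.cells), c.1 ∈ lam := fun c => (Finset.mem_sdiff.1 c.2).1
  refine ⟨fun c c' h1 h2 => ?_, fun c c' h1 h2 => ?_, fun c c' h1 h2 => ?_,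
    fun c c' h1 h2 => ?_⟩ <;> simp only [extendFilling]
  · by_cases m' : c'.1 ∈ mu.cells \ rho.cells
    · rw [dif_pos m', dif_pos (hlow c c' ⟨h1.le, h2.le⟩ m')]
      exact hT.row_weak _ _ h1 h2
    · rw [dif_neg m']
      split_ifs
      · exact (ha _).le
      · exact le_rfl
  · by_cases m' : c'.1 ∈ mu.cells \ rho.cells
    · rw [dif_pos m', dif_pos (hlow c c' ⟨h2.le, h1.le⟩ m')]
      exact hT.col_weak _ _ h1 h2
    · rw [dif_neg m']
      split_ifs
      · exact (ha _).le
      · exact le_rfl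
  · by_cases m' : c'.1 ∈ mu.cells \ rho.cells
    · rw [dif_pos m', dif_pos (hlow c c' ⟨h1.le, h2.le⟩ m')]
      exact hT.row_primed _ _ h1 h2
    · rw [dif_neg m']
      split_ifs with m
      · exact fun _ => (ha _).ne
      · refine fun hp => absurd (hmu c (hs.vertical hp c.1.1 c.1.2 ?_)) m
        exact lam.up_left_mem h1.le h2 (hlam c')
  · by_cases m' : c'.1 ∈ mu.cells \ rho.cells
    · rw [dif_pos m', dif_pos (hlow c c' ⟨h2.le, h1.le⟩ m')]
      exact hT.col_unprimed _ _ h1 h2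
    · rw [dif_neg m']
      split_ifs with m
      · exact fun _ => (ha _).ne
      · refine fun hp => absurd (hmu c (hs.horizontal hp c.1.1 c.1.2 ?_)) m
        exact lam.up_left_mem h2 h1.le (hlam c')

theorem prod_extendFilling {B : Type*} (w : B → R) {a : B} {lam mu rho : YoungDiagram}
    (h1 : rho ≤ mu) (h2 : mu ≤ lam) (T : ↥(mu.cells \ rho.cells) → B) :
    ∏ c, w ((extendFilling a T : ↥(lam.cells \ rho.cells) → B) c) =
      w a ^ (lam.card - mu.card) * ∏ c, w (T c) := by
  obtain ⟨f, hf⟩ : ∃ f : ℕ × ℕ → R, f = fun c =>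
    if h : c ∈ mu.cells \ rho.cells then w (T ⟨c, h⟩) else w a := ⟨_, rfl⟩
  have e : ∀ c : ↥(lam.cells \ rho.cells), w (extendFilling a T c) = f c.1 := by
    intro c
    simp only [extendFilling, hf]
    split_ifs <;> rfl
  have e2 : ∀ c : ↥(mu.cells \ rho.cells), w (T c) = f c.1 := by
    intro c
    simp only [hf]
    rw [dif_pos c.2]
  rw [Finset.prod_congr rfl fun c _ => e c, Finset.prod_congr rfl fun c _ => e2 c,
    Finset.prod_coe_sort (lam.cells \ rho.cells) f, Finset.prod_coe_sort (mu.cells \ rho.cells) f,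
    ← Finset.sdiff_union_sdiff_cancel h2 h1, Finset.prod_union]
  · congr 1
    rw [Finset.prod_congr rfl fun c hc => show f c = w a from ?_, Finset.prod_const,
      Finset.card_sdiff_of_subset h2]
    rw [hf]
    exact dif_neg fun h => (Finset.mem_sdiff.1 hc).2 (Finset.mem_sdiff.1 h).1
  · refine Finset.disjoint_left.2 fun c hc hc' => ?_
    exact (Finset.mem_sdiff.1 hc).2 (Finset.mem_sdiff.1 hc').1

theorem tabSum_empty (primed : A → Prop) (w : A → R) {lam mu : YoungDiagram} (h : mu ≤ lam) :
    tabSum primed w ∅ lam mu = if mu = lam then 1 else 0 := by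
  rw [tabSum]
  split_ifs with heq
  · subst heq
    have : IsEmpty ↥(mu.cells \ mu.cells) := by rw [Finset.sdiff_self]; infer_instance
    rw [Finset.filter_true_of_mem, Finset.sum_congr rfl fun T _ => Finset.prod_of_isEmpty _]
    · rw [Finset.sum_const, Fintype.card_piFinset, Finset.prod_of_isEmpty, one_smul]
    · exact fun T _ => ⟨fun c => isEmptyElim c, fun c => isEmptyElim c, fun c => isEmptyElim c,
        fun c => isEmptyElim c⟩
  · obtain ⟨c, hc⟩ : (lam.cells \ mu.cells).Nonempty := by
      rw [Finset.sdiff_nonempty]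
      exact fun h' => heq (le_antisymm h h')
    refine Finset.sum_eq_zero fun T hT => ?_
    have := Fintype.mem_piFinset.1 (Finset.mem_filter.1 hT).1 ⟨c, hc⟩
    simp at this

/-- The cells of the largest letter of a tableau form a strip, whose removal leaves a tableau in
the other letters. -/
theorem tabSum_insert (primed : A → Prop) (w : A → R) {t : Finset A} {a : A} (ha : ∀ b ∈ t, b < a)
    {lam rho : YoungDiagram} (hle : rho ≤ lam) :
    tabSum primed w (insert a t) lam rho =
      ∑ mu ∈ (stripsBelow (primed a) lam).filter (fun mu => rho ≤ mu),
        w a ^ (lam.card - mu.card) * tabSum primed w t mu rho := by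
  have hA : ∀ {T : ↥(lam.cells \ rho.cells) → A},
      T ∈ (Fintype.piFinset fun _ : ↥(lam.cells \ rho.cells) => insert a t).filter
        (IsTableau primed) → (∀ c, T c ∈ insert a t) ∧ IsTableau primed T ∧ ∀ c, T c ≤ a := by
    intro T hT
    rw [Finset.mem_filter, Fintype.mem_piFinset] at hT
    refine ⟨hT.1, hT.2, fun c => ?_⟩
    rcases Finset.mem_insert.1 (hT.1 c) with h | h
    · exact h.le
    · exact (ha _ h).le
  rw [tabSum, ← Finset.sum_fiberwise_of_maps_to (g := fun T => shapeBelow a T)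
    (t := (stripsBelow (primed a) lam).filter (fun mu => rho ≤ mu))]
  swap
  · intro T hT
    obtain ⟨-, h2, h3⟩ := hA hT
    rw [Finset.mem_filter, mem_stripsBelow]
    refine ⟨isStrip_shapeBelow h2 h3, fun c hc => (mem_shapeBelow h2 h3).2 ⟨hle hc, fun h => ?_⟩⟩
    exact absurd hc (Finset.mem_sdiff.1 h).2
  refine Finset.sum_congr rfl fun mu hmu => ?_
  rw [Finset.mem_filter, mem_stripsBelow] at hmu
  obtain ⟨hs, hrm⟩ := hmu
  have hsub : mu.cells \ rho.cells ⊆ lam.cells \ rho.cells :=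
    Finset.sdiff_subset_sdiff hs.le (Finset.Subset.refl _)
  rw [tabSum, Finset.mul_sum]
  have hleft : ∀ T ∈ ((Fintype.piFinset fun _ : ↥(lam.cells \ rho.cells) => insert a t).filter
      (IsTableau primed)).filter (fun T => shapeBelow a T = mu),
      extendFilling a (fun c : ↥(mu.cells \ rho.cells) => T ⟨c.1, hsub c.2⟩) = T := by
    intro T hT
    rw [Finset.mem_filter] at hT
    obtain ⟨hT, hsh⟩ := hT
    obtain ⟨h1, h2, h3⟩ := hA hT
    funext c
    rw [extendFilling]
    split_ifs with hc
    · rfl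
    · by_contra hne
      have hcm : c.1 ∈ shapeBelow a T := (mem_shapeBelow h2 h3).2
        ⟨(Finset.mem_sdiff.1 c.2).1, fun _ h => hne h.symm⟩
      rw [hsh] at hcm
      exact hc (Finset.mem_sdiff.2 ⟨hcm, (Finset.mem_sdiff.1 c.2).2⟩)
  refine Finset.sum_bij' (fun T _ c => T ⟨c.1, hsub c.2⟩) (fun T' _ => extendFilling a T')
    ?_ ?_ hleft ?_ ?_
  · intro T hT
    rw [Finset.mem_filter] at hT
    obtain ⟨hT, hsh⟩ := hT
    obtain ⟨h1, h2, h3⟩ := hA hT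
    rw [Finset.mem_filter, Fintype.mem_piFinset]
    refine ⟨fun c => ?_, ⟨fun c c' => h2.row_weak ⟨c.1, hsub c.2⟩ ⟨c'.1, hsub c'.2⟩,
      fun c c' => h2.col_weak ⟨c.1, hsub c.2⟩ ⟨c'.1, hsub c'.2⟩,
      fun c c' => h2.row_primed ⟨c.1, hsub c.2⟩ ⟨c'.1, hsub c'.2⟩,
      fun c c' => h2.col_unprimed ⟨c.1, hsub c.2⟩ ⟨c'.1, hsub c'.2⟩⟩⟩
    have hc : c.1 ∈ shapeBelow a T := by
      rw [hsh]
      exact (Finset.mem_sdiff.1 c.2).1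
    exact (Finset.mem_insert.1 (h1 _)).resolve_left (((mem_shapeBelow h2 h3).1 hc).2 (hsub c.2))
  · intro T' hT'
    rw [Finset.mem_filter, Fintype.mem_piFinset] at hT'
    have hlt : ∀ c, T' c < a := fun c => ha _ (hT'.1 c)
    have htab := isTableau_extendFilling hs hT'.2 hlt
    have hmem : ∀ c, (extendFilling a T' : ↥(lam.cells \ rho.cells) → A) c ∈ insert a t := by
      intro c
      rw [extendFilling]
      split_ifs
      · exact Finset.mem_insert_of_mem (hT'.1 _)
      · exact Finset.mem_insert_self _ _
    have hmem' : (extendFilling a T' : ↥(lam.cells \ rho.cells) → A) ∈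
        (Fintype.piFinset fun _ : ↥(lam.cells \ rho.cells) => insert a t).filter
          (IsTableau primed) :=
      Finset.mem_filter.2 ⟨Fintype.mem_piFinset.2 hmem, htab⟩
    refine Finset.mem_filter.2 ⟨hmem', ?_⟩
    ext c
    rw [YoungDiagram.mem_cells, YoungDiagram.mem_cells, mem_shapeBelow htab (hA hmem').2.2]
    constructor
    · rintro ⟨h1, h2⟩
      by_contra hc
      have h3 : c ∈ lam.cells \ rho.cells := Finset.mem_sdiff.2 ⟨h1, fun h => hc (hrm h)⟩
      refine h2 h3 ?_
      rw [extendFilling, dif_neg]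
      exact fun h => hc (Finset.mem_sdiff.1 h).1
    · intro hc
      refine ⟨hs.le hc, fun h3 => ?_⟩
      rw [extendFilling, dif_pos (Finset.mem_sdiff.2 ⟨hc, (Finset.mem_sdiff.1 h3).2⟩)]
      exact (hlt _).ne
  · intro T' hT'
    funext c
    simp only [extendFilling]
    rw [dif_pos c.2]
  · intro T hT
    rw [← prod_extendFilling w hrm hs.le, hleft T hT]

/-- Adjoin the letters in `t` to the alphabet of a family indexed by diagrams. -/
def adjoinLetters (primed : A → Prop) (w : A → R) (t : Finset A) (F : YoungDiagram → R)
    (lam : YoungDiagram) : R :=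
  ∑ mu ∈ (finite_Iic lam).toFinset, F mu * tabSum primed w t lam mu

theorem adjoinLetters_empty (primed : A → Prop) (w : A → R) (F : YoungDiagram → R) :
    adjoinLetters primed w ∅ F = F := by
  funext lam
  rw [adjoinLetters, Finset.sum_eq_single lam]
  · rw [tabSum_empty _ _ le_rfl, if_pos rfl, mul_one]
  · intro mu hmu hne
    rw [tabSum_empty _ _ (by simpa using hmu), if_neg hne, mul_zero]
  · intro h
    simp at h

theorem adjoinLetters_insert (primed : A → Prop) (w : A → R) {t : Finset A} {a : A}
    (ha : ∀ b ∈ t, b < a) (F : YoungDiagram → R) :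
    adjoinLetters primed w (insert a t) F =
      addLetter (primed a) (w a) (adjoinLetters primed w t F) := by
  funext lam
  simp only [adjoinLetters, addLetter, Finset.mul_sum]
  rw [Finset.sum_congr rfl fun rho hrho => by
    rw [tabSum_insert primed w ha (by simpa using hrho), Finset.mul_sum]]
  rw [Finset.sum_comm' (s' := fun mu => (finite_Iic mu).toFinset)
    (t' := stripsBelow (primed a) lam)]
  · exact Finset.sum_congr rfl fun mu _ => Finset.sum_congr rfl fun rho _ => by ring
  · intro rho mu
    simp only [Finset.mem_filter, mem_stripsBelow, Set.Finite.mem_toFinset, Set.mem_Iic]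
    exact ⟨fun h => ⟨h.2.2, h.2.1⟩, fun h => ⟨h.1.trans h.2.le, h.2, h.1⟩⟩

theorem SatisfiesPieri.adjoinLetters {H : PowerSeries R} {F : YoungDiagram → R}
    (h : SatisfiesPieri H F) (primed : A → Prop) (w : A → R) (t : Finset A) :
    SatisfiesPieri ((∏ a ∈ t, letterSeries (primed a) (w a)) * H)
      (adjoinLetters primed w t F) := by
  induction t using Finset.induction_on_max with
  | empty => rwa [Finset.prod_empty, one_mul, adjoinLetters_empty]
  | insert a t ha ih =>
    rw [adjoinLetters_insert primed w ha, Finset.prod_insert fun hm => (ha a hm).false, mul_assoc]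
    exact ih.addLetter _ _

/-- The Schur functions in the empty alphabet. -/
def unitFamily (lam : YoungDiagram) : R := if lam = ⊥ then 1 else 0

theorem satisfiesPieri_unitFamily :
    SatisfiesPieri 1 (unitFamily : YoungDiagram → R) := by
  intro n
  cases n with
  | zero => rw [pieriSum_zero, PowerSeries.coeff_zero_one, one_smul]
  | succ n =>
    funext mu
    rw [pieriSum, PowerSeries.coeff_one, if_neg (Nat.succ_ne_zero n), zero_smul]
    refine Finset.sum_eq_zero fun lam hlam => if_neg ?_
    rintro rfl
    have := (mem_stripsAbove.1 hlam).2
    simp [YoungDiagram.card] at this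

theorem adjoinLetters_unitFamily (primed : A → Prop) (w : A → R) (t : Finset A) :
    adjoinLetters primed w t unitFamily = fun lam => tabSum primed w t lam ⊥ := by
  funext lam
  rw [adjoinLetters, Finset.sum_eq_single ⊥]
  · rw [unitFamily, if_pos rfl, one_mul]
  · intro mu _ hne
    rw [unitFamily, if_neg hne, zero_mul]
  · intro h
    simp at h

theorem adjoinLetters_bot (primed : A → Prop) (w : A → R) (t : Finset A) (F : YoungDiagram → R) :
    adjoinLetters primed w t F ⊥ = F ⊥ := by
  induction t using Finset.induction_on_max with
  | empty => rw [adjoinLetters_empty]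
  | insert a t ha ih =>
    rw [adjoinLetters_insert primed w ha, addLetter, Finset.sum_eq_single ⊥, Nat.sub_self, pow_zero,
      one_mul, ih]
    · exact fun mu hmu hne => absurd (le_bot_iff.1 (mem_stripsBelow.1 hmu).le) hne
    · exact fun h => absurd (mem_stripsBelow.2 (isStrip_refl _ _)) h

end TableauSums

/-! ### Newton's identities -/

section Newton

variable {R : Type*} [CommRing R]

/-- `H` is the generating function of the complete symmetric functions whose power sums are
`p 0, p 1, …` in degrees `1, 2, …`; this is Newton's identity `H' = P H`. -/
structure IsNewton (H : PowerSeries R) (p : ℕ → R) : Prop where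
  constantCoeff : PowerSeries.constantCoeff H = 1
  derivative : PowerSeries.derivative R H = PowerSeries.mk p * H

theorem isNewton_one : IsNewton (1 : PowerSeries R) 0 := by
  refine ⟨map_one _, ?_⟩
  rw [PowerSeries.derivative_one, mul_one]
  ext n
  simp

theorem IsNewton.mul {H H' : PowerSeries R} {p p' : ℕ → R} (h : IsNewton H p)
    (h' : IsNewton H' p') : IsNewton (H * H') (p + p') := by
  refine ⟨by rw [map_mul, h.constantCoeff, h'.constantCoeff, mul_one], ?_⟩
  have e : PowerSeries.mk (p + p') = PowerSeries.mk p + PowerSeries.mk p' := by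
    ext n
    simp
  rw [Derivation.leibniz, h.derivative, h'.derivative, e, smul_eq_mul, smul_eq_mul]
  ring

theorem IsNewton.prod {A : Type*} (t : Finset A) {H : A → PowerSeries R} {p : A → ℕ → R}
    (h : ∀ a ∈ t, IsNewton (H a) (p a)) : IsNewton (∏ a ∈ t, H a) (∑ a ∈ t, p a) := by
  induction t using Finset.induction_on with
  | empty => simpa using isNewton_one
  | insert a t ha ih =>
    rw [Finset.prod_insert ha, Finset.sum_insert ha]
    exact (h a (Finset.mem_insert_self _ _)).mul
      (ih fun b hb => h b (Finset.mem_insert_of_mem hb))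

/-- The power sum of degree `n + 1` of a single letter, with a sign if it is primed. -/
def letterPower (b : Prop) (x : R) (n : ℕ) : R :=
  if b then (-1) ^ n * x ^ (n + 1) else x ^ (n + 1)

theorem map_letterPower {R' F : Type*} [CommRing R'] [FunLike F R R'] [RingHomClass F R R'] (f : F)
    (b : Prop) (x : R) (n : ℕ) : f (letterPower b x n) = letterPower b (f x) n := by
  simp only [letterPower]
  split_ifs <;> simp only [map_mul, map_pow, map_neg, map_one]

theorem isNewton_letterSeries (b : Prop) (x : R) :
    IsNewton (letterSeries b x) (letterPower b x) := by
  by_cases hb : b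
  · rw [letterSeries, if_pos hb]
    refine ⟨by simp, ?_⟩
    have h1 : PowerSeries.derivative R (1 + PowerSeries.C x * PowerSeries.X) =
        PowerSeries.C x := by
      rw [map_add, PowerSeries.derivative_one, Derivation.leibniz, PowerSeries.derivative_X,
        PowerSeries.derivative_C, smul_zero, add_zero, zero_add, smul_eq_mul, mul_one]
    rw [h1, mul_add, mul_one, mul_left_comm]
    ext n
    rw [map_add, PowerSeries.coeff_C_mul, PowerSeries.coeff_mk, letterPower, if_pos hb]
    cases n with
    | zero => simp
    | succ n =>
      rw [PowerSeries.coeff_succ_mul_X, PowerSeries.coeff_mk, letterPower, if_pos hb,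
        PowerSeries.coeff_C, if_neg (Nat.succ_ne_zero n)]
      ring
  · rw [letterSeries, if_neg hb]
    refine ⟨by simp [← PowerSeries.coeff_zero_eq_constantCoeff_apply], ?_⟩
    ext n
    rw [PowerSeries.coeff_derivative, PowerSeries.coeff_mk, PowerSeries.coeff_mul,
      Finset.sum_congr rfl fun ij hij => show _ = x ^ (n + 1) from ?_]
    · simp [mul_comm]
    · rw [PowerSeries.coeff_mk, PowerSeries.coeff_mk, letterPower, if_neg hb, ← pow_add,
        ← Finset.HasAntidiagonal.mem_antidiagonal.1 hij]
      congr 1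
      omega

variable (K : Type*) [Field K]

/-- The complete symmetric functions as polynomials in the power sums; the variable `X n` stands
for the power sum of degree `n + 1`. -/
def complete : ℕ → MvPolynomial ℕ K
  | 0 => 1
  | n + 1 => MvPolynomial.C ((n + 1 : K)⁻¹) *
      ∑ i : Fin (n + 1), MvPolynomial.X i.1 * complete (n - i)

theorem complete_zero : complete K 0 = 1 := by
  rw [complete]

theorem smul_complete_succ [CharZero K] (n : ℕ) :
    (n + 1 : K) • complete K (n + 1) =
      ∑ i ∈ Finset.range (n + 1), MvPolynomial.X i * complete K (n - i) := by
  rw [complete, ← MvPolynomial.smul_eq_C_mul, smul_smul, mul_inv_cancel₀ (Nat.cast_add_one_ne_zero n),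
    one_smul, Finset.sum_range]

variable {K} [CharZero K] [Algebra K R]

theorem IsNewton.coeff_eq {H : PowerSeries R} {p : ℕ → R} (h : IsNewton H p) (n : ℕ) :
    PowerSeries.coeff n H = MvPolynomial.aeval p (complete K n) := by
  induction n using Nat.strong_induction_on with
  | _ n ih =>
    cases n with
    | zero =>
      rw [PowerSeries.coeff_zero_eq_constantCoeff_apply, h.constantCoeff, complete_zero, map_one]
    | succ n =>
      have h1 := congrArg (PowerSeries.coeff n) h.derivative
      rw [PowerSeries.coeff_derivative, PowerSeries.coeff_mul,
        Finset.Nat.sum_antidiagonal_eq_sum_range_succ_mk] at h1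
      have h2 := congrArg (MvPolynomial.aeval p) (smul_complete_succ K n)
      rw [map_smul, map_sum] at h2
      have h3 : (n + 1 : K) • PowerSeries.coeff (n + 1) H =
          (n + 1 : K) • MvPolynomial.aeval p (complete K (n + 1)) := by
        rw [h2, Algebra.smul_def, map_add, map_natCast, map_one, mul_comm, h1]
        refine Finset.sum_congr rfl fun i _ => ?_
        rw [map_mul, MvPolynomial.aeval_X, PowerSeries.coeff_mk, ih (n - i) (by omega)]
      have h4 := congrArg (fun r : R => (n + 1 : K)⁻¹ • r) h3
      simpa only [smul_smul, inv_mul_cancel₀ (Nat.cast_add_one_ne_zero (R := K) n), one_smul] using h4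

variable (K) in
theorem adjoin_complete : Algebra.adjoin K (Set.range (complete K)) = ⊤ := by
  rw [eq_top_iff, ← MvPolynomial.adjoin_range_X, Algebra.adjoin_le_iff]
  rintro _ ⟨n, rfl⟩
  rw [SetLike.mem_coe]
  have hc : ∀ m, complete K m ∈ Algebra.adjoin K (Set.range (complete K)) := fun m =>
    Algebra.subset_adjoin ⟨m, rfl⟩
  induction n using Nat.strong_induction_on with
  | _ n ih =>
    have h := smul_complete_succ K n
    rw [Finset.sum_range_succ, Nat.sub_self, complete_zero, mul_one] at h
    rw [eq_sub_of_add_eq' h.symm]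
    exact sub_mem (Subalgebra.smul_mem _ (hc _) _)
      (sum_mem fun i hi => mul_mem (ih i (Finset.mem_range.1 hi)) (hc _))

end Newton

/-! ### Schur functions as universal polynomials in the power sums -/

/-- The family `S` behaves like the Schur functions in an alphabet with power sums
`p 0, p 1, …` in degrees `1, 2, …`. -/
structure IsSchurFamily (K : Type*) [Field K] {R : Type*} [CommRing R] [Algebra K R]
    (p : ℕ → R) (S : YoungDiagram → R) : Prop where
  bot : S ⊥ = 1
  pieri : ∀ n, pieriSum n S = MvPolynomial.aeval p (complete K n) • S

theorem SatisfiesPieri.isSchurFamily {K : Type*} [Field K] [CharZero K] {R : Type*} [CommRing R]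
    [Algebra K R] {H : PowerSeries R} {p : ℕ → R} {S : YoungDiagram → R}
    (h : SatisfiesPieri H S) (hp : IsNewton H p) (hbot : S ⊥ = 1) : IsSchurFamily K p S :=
  ⟨hbot, fun n => by rw [h, hp.coeff_eq (K := K)]⟩

theorem colLen_zero_le_iff {lam : YoungDiagram} {N : ℕ} :
    lam.colLen 0 ≤ N ↔ lam.rowLen N = 0 := by
  refine ⟨rowLen_eq_zero, fun h => ?_⟩
  by_contra hlt
  have h1 : (N, 0) ∈ lam := YoungDiagram.mem_iff_lt_colLen.2 (not_le.1 hlt)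
  rw [YoungDiagram.mem_iff_lt_rowLen] at h1
  omega

/-- The diagram consisting of the first `l` rows of `lam`. -/
def firstRows (l : ℕ) (lam : YoungDiagram) : YoungDiagram :=
  ofRowFun fun i => if i < l then lam.rowLen i else 0

theorem rowLen_firstRows (l : ℕ) (lam : YoungDiagram) (i : ℕ) :
    (firstRows l lam).rowLen i = if i < l then lam.rowLen i else 0 := by
  refine rowLen_ofRowFun (N := l) (f := fun i => if i < l then lam.rowLen i else 0)
    (fun i j hij => ?_) (by simp) i
  have := lam.rowLen_anti i j hij
  dsimp only
  split_ifs <;> omega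

theorem card_firstRows {l : ℕ} {lam : YoungDiagram} (h : lam.rowLen (l + 1) = 0) :
    lam.card = (firstRows l lam).card + lam.rowLen l := by
  rw [card_eq_sum_rowLen lam (colLen_zero_le_iff.2 h),
    card_eq_sum_rowLen (firstRows l lam) (N := l)
      (colLen_zero_le_iff.2 (by rw [rowLen_firstRows, if_neg (lt_irrefl l)])),
    Finset.sum_range_succ]
  congr 1
  exact Finset.sum_congr rfl fun i hi => by
    rw [rowLen_firstRows, if_pos (Finset.mem_range.1 hi)]

theorem mem_stripsAbove_firstRows {l : ℕ} {lam : YoungDiagram} (h : lam.rowLen (l + 1) = 0) :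
    lam ∈ stripsAbove (lam.rowLen l) (firstRows l lam) := by
  rw [mem_stripsAbove, isStrip_false_iff]
  refine ⟨fun i => ?_, card_firstRows h⟩
  have := lam.rowLen_anti i (i + 1) (Nat.le_succ i)
  rw [rowLen_firstRows]
  split_ifs with hi
  · omega
  · have := lam.rowLen_anti (l + 1) (i + 1) (by omega)
    omega

theorem rowLen_of_mem_stripsAbove_firstRows {l : ℕ} {lam nu : YoungDiagram}
    (hnu : nu ∈ stripsAbove (lam.rowLen l) (firstRows l lam)) :
    nu.rowLen (l + 1) = 0 ∧ (nu ≠ lam → lam.rowLen (l + 1) = 0 → nu.rowLen l < lam.rowLen l) := by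
  rw [mem_stripsAbove, isStrip_false_iff] at hnu
  obtain ⟨h1, h2⟩ := hnu
  have h0 : nu.rowLen (l + 1) = 0 := by
    have := h1 l
    rw [rowLen_firstRows, if_neg (lt_irrefl l)] at this
    omega
  refine ⟨h0, fun hne hl => ?_⟩
  have hle : ∀ i ∈ Finset.range l, (firstRows l lam).rowLen i ≤ nu.rowLen i := fun i _ => (h1 i).1
  rw [card_eq_sum_rowLen nu (colLen_zero_le_iff.2 h0), Finset.sum_range_succ,
    card_eq_sum_rowLen (firstRows l lam) (N := l)
      (colLen_zero_le_iff.2 (by rw [rowLen_firstRows, if_neg (lt_irrefl l)]))] at h2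
  have h3 := Finset.sum_le_sum hle
  by_contra hlt
  have h4 := (Finset.sum_eq_sum_iff_of_le hle).1 (by omega)
  refine hne (ext_rowLen fun i => ?_)
  rcases lt_trichotomy i l with hi | rfl | hi
  · rw [← h4 i (Finset.mem_range.2 hi), rowLen_firstRows, if_pos hi]
  · omega
  · have a1 := nu.rowLen_anti (l + 1) i hi
    have a2 := lam.rowLen_anti (l + 1) i hi
    omega

variable (K : Type u) [Field K]

/-- By Pieri's rule a Schur function is a polynomial in the complete symmetric functions, the same
one for all alphabets: adding a strip of the size of the last row to the other rows
gives the diagram itself and diagrams with a shorter last row. -/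
theorem exists_schurPoly (lam : YoungDiagram) : ∃ Q : MvPolynomial ℕ K,
    ∀ (R : Type u) [CommRing R] [Algebra K R] (p : ℕ → R) (S : YoungDiagram → R),
      IsSchurFamily K p S → S lam = MvPolynomial.aeval p Q := by
  suffices h : ∀ l, ∀ lam : YoungDiagram, lam.rowLen l = 0 → ∃ Q : MvPolynomial ℕ K,
      ∀ (R : Type u) [CommRing R] [Algebra K R] (p : ℕ → R) (S : YoungDiagram → R),
        IsSchurFamily K p S → S lam = MvPolynomial.aeval p Q from
    h _ lam (rowLen_eq_zero le_rfl)
  intro l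
  induction l with
  | zero =>
    intro lam hlam
    obtain rfl : lam = ⊥ := by
      refine ext_rowLen fun i => ?_
      have a1 := lam.rowLen_anti 0 i (Nat.zero_le i)
      have a2 := le_iff_rowLen.1 (bot_le : ⊥ ≤ lam) i
      omega
    exact ⟨1, fun R _ _ p S h => by rw [h.bot, map_one]⟩
  | succ l ihl =>
    suffices h : ∀ r, ∀ lam : YoungDiagram, lam.rowLen (l + 1) = 0 → lam.rowLen l = r →
        ∃ Q : MvPolynomial ℕ K, ∀ (R : Type u) [CommRing R] [Algebra K R] (p : ℕ → R)
          (S : YoungDiagram → R), IsSchurFamily K p S → S lam = MvPolynomial.aeval p Q from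
      fun lam hlam => h _ lam hlam rfl
    intro r
    induction r using Nat.strong_induction_on with
    | _ r ihr =>
      intro lam hlam hr
      obtain ⟨Q₀, hQ₀⟩ := ihl (firstRows l lam) (by rw [rowLen_firstRows, if_neg (lt_irrefl l)])
      have hQ : ∀ nu ∈ (stripsAbove (lam.rowLen l) (firstRows l lam)).erase lam,
          ∃ Q : MvPolynomial ℕ K, ∀ (R : Type u) [CommRing R] [Algebra K R] (p : ℕ → R)
            (S : YoungDiagram → R), IsSchurFamily K p S → S nu = MvPolynomial.aeval p Q := by
        intro nu hnu
        rw [Finset.mem_erase] at hnu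
        have h1 := rowLen_of_mem_stripsAbove_firstRows hnu.2
        exact ihr _ (hr ▸ h1.2 hnu.1 hlam) nu h1.1 rfl
      choose! Q hQ using hQ
      refine ⟨complete K (lam.rowLen l) * Q₀ -
        ∑ nu ∈ (stripsAbove (lam.rowLen l) (firstRows l lam)).erase lam, Q nu,
        fun R _ _ p S h => ?_⟩
      have h1 := congrFun (h.pieri (lam.rowLen l)) (firstRows l lam)
      rw [pieriSum, ← Finset.add_sum_erase _ _ (mem_stripsAbove_firstRows hlam),
        Pi.smul_apply, smul_eq_mul] at h1
      rw [eq_sub_of_add_eq h1, map_sub, map_mul, map_sum, hQ₀ R p S h,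
        Finset.sum_congr rfl fun nu hnu => hQ nu hnu R p S h]

/-- The Schur function of shape `lam` as a polynomial in the power sums. -/
def schurPoly (lam : YoungDiagram) : MvPolynomial ℕ K := (exists_schurPoly K lam).choose

variable {K}

theorem IsSchurFamily.eq_aeval {R : Type u} [CommRing R] [Algebra K R] {p : ℕ → R}
    {S : YoungDiagram → R} (h : IsSchurFamily K p S) (lam : YoungDiagram) :
    S lam = MvPolynomial.aeval p (schurPoly K lam) :=
  (exists_schurPoly K lam).choose_spec R p S h

/-- Every polynomial in the power sums is a combination of Schur functions, with the same
coefficients for all alphabets. -/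
theorem exists_schur_expansion [CharZero K] (F : MvPolynomial ℕ K) : ∃ m : YoungDiagram →₀ K,
    ∀ (R : Type u) [CommRing R] [Algebra K R] (p : ℕ → R) (S : YoungDiagram → R),
      IsSchurFamily K p S → MvPolynomial.aeval p F = Finsupp.linearCombination K S m := by
  have key : ∀ G ∈ Algebra.adjoin K (Set.range (complete K)), ∀ m : YoungDiagram →₀ K,
      ∃ m' : YoungDiagram →₀ K, ∀ (R : Type u) [CommRing R] [Algebra K R] (p : ℕ → R)
        (S : YoungDiagram → R), IsSchurFamily K p S →
          MvPolynomial.aeval p G * Finsupp.linearCombination K S m =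
            Finsupp.linearCombination K S m' := by
    intro G hG
    induction hG using Algebra.adjoin_induction with
    | mem G hG =>
      obtain ⟨n, rfl⟩ := hG
      intro m
      refine ⟨m.sum fun lam c => c • ∑ nu ∈ stripsAbove n lam, Finsupp.single nu 1,
        fun R _ _ p S h => ?_⟩
      rw [map_finsuppSum, Finsupp.linearCombination_apply, Finsupp.sum, Finsupp.sum,
        Finset.mul_sum]
      refine Finset.sum_congr rfl fun lam _ => ?_
      have h1 := congrFun (h.pieri n) lam
      rw [Pi.smul_apply, smul_eq_mul] at h1
      rw [map_smul, map_sum, mul_smul_comm, ← h1, pieriSum]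
      simp
    | algebraMap r =>
      intro m
      exact ⟨r • m, fun R _ _ p S h => by
        rw [MvPolynomial.algebraMap_eq, MvPolynomial.aeval_C, map_smul, Algebra.smul_def]⟩
    | add G G' _ _ ih ih' =>
      intro m
      obtain ⟨m1, h1⟩ := ih m
      obtain ⟨m2, h2⟩ := ih' m
      exact ⟨m1 + m2, fun R _ _ p S h => by
        rw [map_add, add_mul, h1 R p S h, h2 R p S h, map_add]⟩
    | mul G G' _ _ ih ih' =>
      intro m
      obtain ⟨m2, h2⟩ := ih' m
      obtain ⟨m1, h1⟩ := ih m2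
      exact ⟨m1, fun R _ _ p S h => by
        rw [map_mul, mul_assoc, h2 R p S h, h1 R p S h]⟩
  obtain ⟨m, hm⟩ := key F (by rw [adjoin_complete]; trivial) (Finsupp.single ⊥ 1)
  refine ⟨m, fun R _ _ p S h => ?_⟩
  rw [← hm R p S h, Finsupp.linearCombination_single, h.bot, one_smul, mul_one]

/-! ### Truncation to finitely many variables -/

section Truncation

variable {A : Type} {K : Type u} [Field K]

/-- The ideal of power series all of whose monomials involve a variable outside `s`; the quotient
by it sets these variables to zero. -/
def outsideIdeal (K : Type u) [Field K] (s : Finset A) : Ideal (MvPowerSeries A K) where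
  carrier := {f | ∀ d : A →₀ ℕ, d.support ⊆ s → MvPowerSeries.coeff d f = 0}
  zero_mem' := fun d _ => map_zero _
  add_mem' := fun {f g} hf hg d hd => by rw [map_add, hf d hd, hg d hd, add_zero]
  smul_mem' := fun c f hf d hd => by
    rw [smul_eq_mul, MvPowerSeries.coeff_mul]
    refine Finset.sum_eq_zero fun p hp => ?_
    have hle : p.2 ≤ d := by
      rw [← Finset.HasAntidiagonal.mem_antidiagonal.1 hp]
      exact le_add_self
    rw [hf p.2 ((Finsupp.support_mono hle).trans hd), mul_zero]

/-- Set the variables outside `s` to zero. -/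
def truncate (K : Type u) [Field K] (s : Finset A) :
    MvPowerSeries A K →ₐ[K] MvPowerSeries A K ⧸ outsideIdeal K s :=
  Ideal.Quotient.mkₐ K (outsideIdeal K s)

theorem truncate_eq_iff {s : Finset A} {f g : MvPowerSeries A K} :
    truncate K s f = truncate K s g ↔ ∀ d : A →₀ ℕ, d.support ⊆ s →
      MvPowerSeries.coeff d f = MvPowerSeries.coeff d g := by
  rw [truncate, Ideal.Quotient.mkₐ_eq_mk, Ideal.Quotient.eq]
  exact forall_congr' fun d => forall_congr' fun _ => by rw [map_sub, sub_eq_zero]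

theorem eq_of_truncate_eq {f g : MvPowerSeries A K}
    (h : ∀ s : Finset A, truncate K s f = truncate K s g) : f = g := by
  ext d
  exact truncate_eq_iff.1 (h d.support) d (Finset.Subset.refl _)

theorem truncate_X_of_notMem {s : Finset A} {a : A} (ha : a ∉ s) :
    truncate K s (MvPowerSeries.X a) = 0 := by
  rw [← map_zero (truncate K s), truncate_eq_iff]
  intro d hd
  rw [MvPowerSeries.coeff_X, if_neg, map_zero]
  rintro rfl
  exact ha (hd (by simp))

theorem prod_X_eq_monomial {ι : Type*} (t : Finset ι) (f : ι → A) :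
    ∏ c ∈ t, (MvPowerSeries.X (f c) : MvPowerSeries A K) =
      MvPowerSeries.monomial (∑ c ∈ t, Finsupp.single (f c) 1) 1 := by
  simp only [MvPowerSeries.X, MvPowerSeries.prod_monomial, Finset.prod_const_one]

theorem truncate_tableauSeries [LinearOrder A] (primed : A → Prop) (lam mu : YoungDiagram)
    (s : Finset A) :
    truncate K s (tableauSeries K primed lam mu) =
      tabSum primed (fun a => truncate K s (MvPowerSeries.X a)) s lam mu := by
  have e : tabSum primed (fun a => truncate K s (MvPowerSeries.X a)) s lam mu =
      truncate K s (tabSum primed (fun a => MvPowerSeries.X a) s lam mu) := by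
    simp only [tabSum, map_sum, map_prod]
  rw [e, truncate_eq_iff]
  intro d hd
  rw [tabSum, map_sum, Finset.sum_congr rfl fun T _ => by
    rw [prod_X_eq_monomial, MvPowerSeries.coeff_monomial], Finset.sum_boole]
  change ((Nat.card _ : ℕ) : K) = _
  congr 1
  refine Nat.subtype_card _ fun T => ?_
  rw [Finset.mem_filter, Finset.mem_filter, Fintype.mem_piFinset]
  constructor
  · rintro ⟨⟨-, h2⟩, h3⟩
    exact ⟨h2, h3.symm⟩
  · rintro ⟨h1, h2⟩
    refine ⟨⟨fun c => hd ?_, h1⟩, h2.symm⟩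
    rw [← h2, content, Finsupp.mem_support_iff, Finsupp.finsetSum_apply]
    refine (lt_of_lt_of_le Nat.zero_lt_one ?_).ne'
    calc 1 = Finsupp.single (T c) 1 (T c) := by simp
      _ ≤ ∑ c', Finsupp.single (T c') 1 (T c) :=
        Finset.single_le_sum (f := fun c' => Finsupp.single (T c') 1 (T c))
          (fun _ _ => Nat.zero_le _) (Finset.mem_univ c)

theorem truncate_aeval (s : Finset A) (p : ℕ → MvPowerSeries A K) (F : MvPolynomial ℕ K) :
    truncate K s (MvPolynomial.aeval p F) =
      MvPolynomial.aeval (fun n => truncate K s (p n)) F :=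
  MvPolynomial.comp_aeval_apply _ _ _

theorem isSchurFamily_of_truncate {p : ℕ → MvPowerSeries A K}
    {S : YoungDiagram → MvPowerSeries A K}
    (h : ∀ s : Finset A, IsSchurFamily K (fun n => truncate K s (p n))
      (fun lam => truncate K s (S lam))) : IsSchurFamily K p S := by
  refine ⟨eq_of_truncate_eq fun s => by rw [(h s).bot, map_one],
    fun n => funext fun mu => eq_of_truncate_eq fun s => ?_⟩
  have h1 := congrFun ((h s).pieri n) mu
  rw [pieriSum, Pi.smul_apply, smul_eq_mul] at h1
  rw [pieriSum, map_sum, h1, Pi.smul_apply, smul_eq_mul, map_mul, truncate_aeval]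

variable [CharZero K] [LinearOrder A]

theorem isSchurFamily_tabSum {R : Type*} [CommRing R] [Algebra K R] (primed : A → Prop)
    (w : A → R) (t : Finset A) :
    IsSchurFamily K (∑ a ∈ t, letterPower (primed a) (w a)) (fun lam => tabSum primed w t lam ⊥) := by
  rw [← adjoinLetters_unitFamily]
  refine (satisfiesPieri_unitFamily.adjoinLetters primed w t).isSchurFamily ?_ ?_
  · rw [mul_one]
    exact IsNewton.prod t fun a _ => isNewton_letterSeries _ _
  · rw [adjoinLetters_bot, unitFamily, if_pos rfl]

theorem isSchurFamily_tableauSeries (primed : A → Prop) {p : ℕ → MvPowerSeries A K}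
    (hp : ∀ (s : Finset A) (n : ℕ), truncate K s (p n) =
      ∑ a ∈ s, letterPower (primed a) (truncate K s (MvPowerSeries.X a)) n) :
    IsSchurFamily K p (fun lam => tableauSeries K primed lam ⊥) := by
  refine isSchurFamily_of_truncate fun s => ?_
  simp only [truncate_tableauSeries]
  convert isSchurFamily_tabSum (K := K) primed (fun a => truncate K s (MvPowerSeries.X a)) s using 1
  funext n
  rw [hp, Finset.sum_apply]

theorem isSchurFamily_tableauSeries_of_fintype [Fintype A] (primed : A → Prop) :
    IsSchurFamily K (fun n => ∑ a, letterPower (primed a) (MvPowerSeries.X a : MvPowerSeries A K) n)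
      (fun lam => tableauSeries K primed lam ⊥) := by
  refine isSchurFamily_tableauSeries primed fun s n => ?_
  rw [map_sum, Finset.sum_congr rfl fun a _ => map_letterPower (truncate K s) _ _ _]
  symm
  refine Finset.sum_subset (Finset.subset_univ s) fun a _ ha => ?_
  rw [truncate_X_of_notMem ha, letterPower]
  split_ifs <;> simp

end Truncation

/-! ### The Schur functions, the hook Schur functions and the doubly Schur functions -/

section Families

variable (K : Type u) [Field K]

theorem truncate_powerSum (n : ℕ) (s : Finset ℕ) :
    truncate K s (powerSum K (n + 1)) = ∑ i ∈ s, truncate K s (MvPowerSeries.X i) ^ (n + 1) := by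
  simp only [← map_pow]
  rw [← map_sum, truncate_eq_iff]
  intro d hd
  rw [map_sum, Finset.sum_congr rfl fun i _ => MvPowerSeries.coeff_X_pow _ _ _]
  change (if ∃ i : ℕ, d = Finsupp.single i (n + 1) then (1 : K) else 0) = _
  split_ifs with h
  · obtain ⟨i, rfl⟩ := h
    have hi : i ∈ s := hd (by simp)
    rw [Finset.sum_eq_single i, if_pos rfl]
    · intro j _ hj
      rw [if_neg]
      intro h
      exact hj (Finsupp.single_left_injective (Nat.succ_ne_zero n) h).symm
    · exact fun h => absurd hi h
  · exact (Finset.sum_eq_zero fun i _ => if_neg fun hi => h ⟨i, hi⟩).symm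

theorem isSchurFamily_schur [CharZero K] :
    IsSchurFamily K (fun n => powerSum K (n + 1)) (schur K) :=
  isSchurFamily_tableauSeries (fun _ => False) fun s n => by
    rw [truncate_powerSum]
    simp only [letterPower, if_false]

/-- Transposition of the shape exchanges the roles of primed and unprimed letters. -/
theorem tableauSeries_transpose {A : Type*} [LinearOrder A] (lam mu : YoungDiagram) :
    tableauSeries K (fun _ : A => False) lam.transpose mu.transpose =
      tableauSeries K (fun _ : A => True) lam mu := by
  funext d
  change ((Nat.card _ : ℕ) : K) = ((Nat.card _ : ℕ) : K)
  congr 1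
  have hmem : ∀ c : ℕ × ℕ, c ∈ lam.cells \ mu.cells ↔
      Equiv.prodComm ℕ ℕ c ∈ lam.transpose.cells \ mu.transpose.cells := fun c => by
    simp only [Finset.mem_sdiff, YoungDiagram.mem_cells, YoungDiagram.mem_transpose,
      Equiv.prodComm_apply, Prod.swap_swap]
  refine Nat.card_congr ((Equiv.arrowCongr ((Equiv.prodComm ℕ ℕ).subtypeEquiv hmem).symm
    (Equiv.refl A)).subtypeEquiv fun T => and_congr ?_ ?_)
  · constructor
    · intro h
      exact ⟨fun c c' h1 h2 => h.col_weak _ _ h1 h2, fun c c' h1 h2 => h.row_weak _ _ h1 h2,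
        fun c c' h1 h2 _ => h.col_unprimed _ _ h1 h2 id, fun c c' h1 h2 h3 => (h3 trivial).elim⟩
    · intro h
      have h' : ∀ c : ↥(lam.transpose.cells \ mu.transpose.cells),
          ∃ b : ↥(lam.cells \ mu.cells), (Equiv.prodComm ℕ ℕ).subtypeEquiv hmem b = c :=
        fun c => ((Equiv.prodComm ℕ ℕ).subtypeEquiv hmem).surjective c
      refine ⟨fun c c' h1 h2 => ?_, fun c c' h1 h2 => ?_, fun _ _ _ _ h3 => h3.elim,
        fun c c' h1 h2 _ => ?_⟩ <;> obtain ⟨b, rfl⟩ := h' c <;> obtain ⟨b', rfl⟩ := h' c'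
      · exact h.col_weak b b' h1 h2
      · exact h.row_weak b b' h1 h2
      · exact h.row_primed b b' h1 h2 trivial
  · rw [content, content]
    have := Equiv.sum_comp ((Equiv.prodComm ℕ ℕ).subtypeEquiv hmem)
      (fun c => Finsupp.single (T c) 1)
    exact Eq.congr this.symm rfl

/-- The doubly Schur function is the Schur function in the alphabet consisting of an unprimed and
a primed copy of the variables. -/
theorem truncate_doublySchur (lam : YoungDiagram) (s : Finset ℕ) :
    truncate K s (doublySchur K lam) =
      adjoinLetters (fun _ => True) (fun i => truncate K s (MvPowerSeries.X i)) s
        (adjoinLetters (fun _ => False) (fun i => truncate K s (MvPowerSeries.X i)) s unitFamily)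
        lam := by
  rw [doublySchur, map_sum, adjoinLetters_unitFamily, adjoinLetters]
  refine Finset.sum_congr rfl fun mu _ => ?_
  rw [map_mul, schur, skewSchur, skewSchur, tableauSeries_transpose, truncate_tableauSeries,
    truncate_tableauSeries]

theorem isSchurFamily_doublySchur [CharZero K] :
    IsSchurFamily K (fun n => (1 + (-1) ^ n) * powerSum K (n + 1)) (doublySchur K) := by
  refine isSchurFamily_of_truncate fun s => ?_
  simp only [truncate_doublySchur]
  refine ((satisfiesPieri_unitFamily.adjoinLetters (fun _ => False)
    (fun i => truncate K s (MvPowerSeries.X i)) s).adjoinLetters (fun _ => True)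
      (fun i => truncate K s (MvPowerSeries.X i)) s).isSchurFamily ?_ ?_
  · have h1 := IsNewton.prod s fun i _ =>
      isNewton_letterSeries False (truncate K s (MvPowerSeries.X i))
    have h2 := IsNewton.prod s fun i _ =>
      isNewton_letterSeries True (truncate K s (MvPowerSeries.X i))
    rw [mul_one]
    convert h2.mul h1 using 1
    funext n
    rw [map_mul, truncate_powerSum, Pi.add_apply, Finset.sum_apply, Finset.sum_apply,
      ← Finset.sum_add_distrib, Finset.mul_sum]
    refine Finset.sum_congr rfl fun i _ => ?_
    simp only [letterPower, if_true, if_false]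
    rw [map_add, map_one, map_pow, map_neg, map_one]
    ring
  · rw [adjoinLetters_bot, adjoinLetters_bot, unitFamily, if_pos rfl]

end Families

/-! ### Power sums take arbitrary values -/

section Realization

variable {L : Type*} [Field L]

theorem exists_prod_one_add_mul_X [IsAlgClosed L] (g : Polynomial L) (hg : g.coeff 0 = 1) :
    ∃ (k : ℕ) (y : Fin k → L), g = ∏ i, (1 + Polynomial.C (y i) * Polynomial.X) := by
  have hg0 : g ≠ 0 := by
    rintro rfl
    simp at hg
  have hroot : ∀ r ∈ g.roots, Polynomial.X - Polynomial.C r =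
      Polynomial.C (-r) * (1 + Polynomial.C (-r⁻¹) * Polynomial.X) := by
    intro r hr
    have hr0 : r ≠ 0 := by
      rintro rfl
      rw [Polynomial.mem_roots hg0, Polynomial.IsRoot, ← Polynomial.coeff_zero_eq_eval_zero, hg]
        at hr
      exact one_ne_zero hr
    rw [mul_add, mul_one, ← mul_assoc, ← Polynomial.C_mul, neg_mul_neg, mul_inv_cancel₀ hr0,
      Polynomial.C_neg, Polynomial.C_1]
    ring
  have h1 := (IsAlgClosed.splits g).eq_prod_roots
  rw [Multiset.map_congr rfl hroot, Multiset.prod_map_mul, ← mul_assoc] at h1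
  obtain ⟨c, hc⟩ : ∃ c : L, Polynomial.C g.leadingCoeff *
      (g.roots.map fun r => Polynomial.C (-r)).prod = Polynomial.C c :=
    ⟨g.leadingCoeff * (g.roots.map fun r => -r).prod, by
      rw [Polynomial.C_mul, map_multiset_prod, Multiset.map_map]
      rfl⟩
  rw [hc] at h1
  have hc1 : c = 1 := by
    have h2 := congrArg (Polynomial.eval 0) h1
    rw [← Polynomial.coeff_zero_eq_eval_zero, hg, Polynomial.eval_mul, Polynomial.eval_C,
      Polynomial.eval_multiset_prod, Multiset.map_map] at h2
    simpa using h2.symm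
  rw [hc1, Polynomial.C_1, one_mul] at h1
  refine ⟨g.roots.toList.length, fun i => -(g.roots.toList[i.1])⁻¹, h1.trans ?_⟩
  rw [Fin.prod_univ_fun_getElem g.roots.toList
    (fun r => 1 + Polynomial.C (-r⁻¹) * Polynomial.X), ← Multiset.prod_coe, ← Multiset.map_coe,
    Multiset.coe_toList]

/-- The complete symmetric functions determine the power sums. -/
theorem eq_of_aeval_complete_eq [CharZero L] {a b : ℕ → L} {N : ℕ}
    (h : ∀ n ≤ N, MvPolynomial.aeval a (complete L n) = MvPolynomial.aeval b (complete L n)) :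
    ∀ n < N, a n = b n := by
  intro n
  induction n using Nat.strong_induction_on with
  | _ n ih =>
    intro hn
    have key : ∀ c : ℕ → L, (n + 1 : L) * MvPolynomial.aeval c (complete L (n + 1)) =
        ∑ i ∈ Finset.range n, c i * MvPolynomial.aeval c (complete L (n - i)) + c n := by
      intro c
      have h2 := congrArg (MvPolynomial.aeval c) (smul_complete_succ L n)
      rw [map_smul, map_sum, Finset.sum_range_succ, Nat.sub_self, complete_zero, mul_one,
        MvPolynomial.aeval_X, smul_eq_mul] at h2
      rw [h2]
      congr 1
      exact Finset.sum_congr rfl fun i _ => by rw [map_mul, MvPolynomial.aeval_X]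
    have ha := key a
    rw [h (n + 1) hn, key b] at ha
    rw [Finset.sum_congr rfl fun i hi => by
      rw [← ih i (Finset.mem_range.1 hi) ((Finset.mem_range.1 hi).trans hn),
        ← h (n - i) ((Nat.sub_le n i).trans hn.le)]] at ha
    exact (add_left_cancel ha).symm

/-- Over an algebraically closed field of characteristic zero, finitely many power sums take any
prescribed values. -/
theorem exists_powerSum_eq [IsAlgClosed L] [CharZero L] (a : ℕ → L) (N : ℕ) :
    ∃ (k : ℕ) (y : Fin k → L), ∀ n < N, ∑ i, y i ^ (n + 1) = a n := by
  -- the `y i` are primed letters, whose power sums carry the sign `(-1) ^ n`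
  obtain ⟨k, y, hy⟩ := exists_prod_one_add_mul_X
    (∑ n ∈ Finset.range (N + 1), Polynomial.monomial n
      (MvPolynomial.aeval (fun n => (-1) ^ n * a n) (complete L n)))
    (by simp [Polynomial.coeff_monomial, complete_zero])
  refine ⟨k, y, fun n hn => ?_⟩
  have hnewton := IsNewton.prod Finset.univ fun i _ => isNewton_letterSeries True (y i)
  have hH : ∏ i, letterSeries True (y i) =
      ((∏ i, (1 + Polynomial.C (y i) * Polynomial.X) : Polynomial L) : PowerSeries L) := by
    rw [← Polynomial.coeToPowerSeries.ringHom_apply, map_prod]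
    refine Finset.prod_congr rfl fun i _ => ?_
    rw [letterSeries, if_pos trivial, Polynomial.coeToPowerSeries.ringHom_apply]
    simp
  have h := eq_of_aeval_complete_eq (a := ∑ i, letterPower True (y i))
    (b := fun n => (-1) ^ n * a n) (N := N) (fun m hm => by
    rw [← hnewton.coeff_eq, hH, ← hy, Polynomial.coeff_coe, Polynomial.finsetSum_coeff]
    simp only [Polynomial.coeff_monomial]
    rw [Finset.sum_ite_eq' (Finset.range (N + 1)) m, if_pos (Finset.mem_range.2 (by omega))]) n hn
  rw [Finset.sum_apply] at h
  simp only [letterPower, if_true] at h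
  rw [← Finset.mul_sum] at h
  exact mul_left_cancel₀ (pow_ne_zero n (neg_ne_zero.2 one_ne_zero)) h

end Realization

section Independence

variable (K : Type u) [Field K]

theorem aeval_coe {A : Type*} (p : ℕ → MvPolynomial A K) (F : MvPolynomial ℕ K) :
    MvPolynomial.aeval (fun n => (p n : MvPowerSeries A K)) F =
      (MvPolynomial.aeval p F : MvPolynomial A K) := by
  have h := MvPolynomial.comp_aeval_apply p
    (MvPolynomial.coeToMvPowerSeries.algHom (σ := A) (R := K) K) F
  simpa [Algebra.algebraMap_self] using h.symm

theorem aeval_congr_of_vars {S : Type*} [CommRing S] [Algebra K S] {F : MvPolynomial ℕ K}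
    {f g : ℕ → S} (h : ∀ n ∈ F.vars, f n = g n) :
    MvPolynomial.aeval f F = MvPolynomial.aeval g F :=
  MvPolynomial.eval₂Hom_congr' rfl (fun i hi _ => h i hi) rfl

theorem aeval_mem_subalgebra {B : Type*} [CommRing B] [Algebra K B] {S : Subalgebra K B}
    {p : ℕ → B} (h : ∀ n, p n ∈ S) (F : MvPolynomial ℕ K) : MvPolynomial.aeval p F ∈ S := by
  have hle : Algebra.adjoin K (Set.range p) ≤ S :=
    Algebra.adjoin_le (Set.range_subset_iff.2 h)
  rw [← MvPolynomial.aeval_range] at hle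
  exact hle (AlgHom.mem_range_self _ F)

theorem exists_vars_lt (F : MvPolynomial ℕ K) : ∃ N, ∀ n ∈ F.vars, n < N :=
  ⟨F.vars.sup id + 1, fun _ hn => Nat.lt_succ_of_le (Finset.le_sup (f := id) hn)⟩

theorem exists_injective_algHom_isAlgClosed [CharZero K] :
    ∃ (L : Type u) (_ : Field L) (_ : Algebra K L) (_ : IsAlgClosed L) (_ : CharZero L)
      (f : MvPolynomial ℕ K →ₐ[K] L), Function.Injective f := by
  refine ⟨AlgebraicClosure (FractionRing (MvPolynomial ℕ K)), inferInstance, inferInstance,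
    inferInstance, charZero_of_injective_algebraMap (algebraMap K _).injective,
    IsScalarTower.toAlgHom K (MvPolynomial ℕ K) _, ?_⟩
  rw [IsScalarTower.coe_toAlgHom', IsScalarTower.algebraMap_eq (MvPolynomial ℕ K)
    (FractionRing (MvPolynomial ℕ K)), RingHom.coe_comp]
  exact (algebraMap (FractionRing (MvPolynomial ℕ K)) _).injective.comp
    (IsFractionRing.injective (MvPolynomial ℕ K) (FractionRing (MvPolynomial ℕ K)))

/-- The symmetric function that is the given polynomial in the power sums. -/
def evalPowerSums : MvPolynomial ℕ K →ₐ[K] MvPowerSeries ℕ K :=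
  MvPolynomial.aeval fun n => powerSum K (n + 1)

/-- The power sums are algebraically independent. -/
theorem evalPowerSums_injective [CharZero K] : Function.Injective (evalPowerSums K) := by
  rw [injective_iff_map_eq_zero]
  intro F hF
  obtain ⟨L, _, _, _, _, f, hf⟩ := exists_injective_algHom_isAlgClosed K
  obtain ⟨N, hN⟩ := exists_vars_lt K F
  obtain ⟨k, y, hy⟩ := exists_powerSum_eq (fun n => f (MvPolynomial.X n)) N
  -- the polynomial in the power sums of the first `k` variables vanishes
  have hG : MvPolynomial.aeval (fun n => ∑ i ∈ Finset.range k,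
      (MvPolynomial.X i : MvPolynomial ℕ K) ^ (n + 1)) F = 0 := by
    have h1 : truncate K (Finset.range k) (MvPolynomial.aeval (fun n => ∑ i ∈ Finset.range k,
        (MvPolynomial.X i : MvPolynomial ℕ K) ^ (n + 1)) F : MvPolynomial ℕ K) =
          truncate K (Finset.range k) 0 := by
      rw [← hF, evalPowerSums, truncate_aeval, ← aeval_coe, truncate_aeval]
      congr 2
      funext n
      rw [truncate_powerSum, ← MvPolynomial.coeToMvPowerSeries.ringHom_apply, map_sum, map_sum]
      refine Finset.sum_congr rfl fun i _ => ?_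
      rw [map_pow, map_pow, MvPolynomial.coeToMvPowerSeries.ringHom_apply, MvPolynomial.coe_X]
    have h2 : MvPolynomial.aeval (fun n => ∑ i ∈ Finset.range k,
        (MvPolynomial.X i : MvPolynomial ℕ K) ^ (n + 1)) F ∈
          MvPolynomial.supported K (Finset.range k : Set ℕ) :=
      aeval_mem_subalgebra K (fun n => sum_mem fun i hi =>
        pow_mem (MvPolynomial.X_mem_supported.2 hi) _) F
    ext d
    by_cases hd : d.support ⊆ Finset.range k
    · simpa using truncate_eq_iff.1 h1 d hd
    · rw [MvPolynomial.coeff_zero]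
      by_contra hne
      refine hd fun i hi => ?_
      exact MvPolynomial.mem_supported.1 h2
        ((MvPolynomial.mem_vars_iff_mem_support _).2 ⟨d, MvPolynomial.mem_support_iff.2 hne, hi⟩)
  have h3 := congrArg (MvPolynomial.aeval fun i => if h : i < k then y ⟨i, h⟩ else 0) hG
  rw [map_zero, MvPolynomial.comp_aeval_apply] at h3
  refine hf ?_
  rw [map_zero, ← h3, ← MvPolynomial.aeval_X_left_apply F, MvPolynomial.comp_aeval_apply,
    MvPolynomial.aeval_X_left_apply]
  refine aeval_congr_of_vars K fun n hn => ?_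
  rw [← hy n (hN n hn), map_sum, Finset.sum_range]
  refine Finset.sum_congr rfl fun i _ => ?_
  rw [map_pow, MvPolynomial.aeval_X, dif_pos i.2]

variable {K}

/-- The power sums of the letters `x_1, …, x_k, y_1, …, y_l`. -/
def powerSumFin (K : Type u) [Field K] (primed : Prop) (k l n : ℕ) :
    MvPowerSeries (Fin k ⊕ₗ Fin l) K :=
  ∑ a, letterPower ((ofLex a).isRight = true ∧ primed) (MvPowerSeries.X a) n

theorem sum_letterPower_lex {R : Type*} [CommRing R] (primed : Prop) {k l : ℕ} (y : Fin k → R)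
    (z : Fin l → R) (n : ℕ) :
    ∑ a : Fin k ⊕ₗ Fin l, letterPower ((ofLex a).isRight = true ∧ primed)
        (Sum.elim y z (ofLex a)) n =
      ∑ i, y i ^ (n + 1) + if primed then (-1) ^ n * ∑ j, z j ^ (n + 1) else
        ∑ j, z j ^ (n + 1) := by
  rw [Equiv.sum_comp (ofLex : Fin k ⊕ₗ Fin l ≃ Fin k ⊕ Fin l)
    (fun a => letterPower (a.isRight = true ∧ primed) (Sum.elim y z a) n), Fintype.sum_sum_type]
  congr 1
  · simp [letterPower]
  · split_ifs with h <;> simp [letterPower, h, Finset.mul_sum]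

theorem aeval_powerSumFin_eq (F : MvPolynomial ℕ K) (primed : Prop) (k l : ℕ) :
    MvPolynomial.aeval (powerSumFin K primed k l) F =
      (MvPolynomial.aeval (fun n => ∑ a : Fin k ⊕ₗ Fin l,
        letterPower ((ofLex a).isRight = true ∧ primed) (MvPolynomial.X a : MvPolynomial _ K) n) F :
          MvPolynomial (Fin k ⊕ₗ Fin l) K) := by
  rw [← aeval_coe]
  congr 2
  funext n
  rw [powerSumFin, ← MvPolynomial.coeToMvPowerSeries.ringHom_apply, map_sum]
  exact Finset.sum_congr rfl fun a _ => by
    rw [map_letterPower, MvPolynomial.coeToMvPowerSeries.ringHom_apply, MvPolynomial.coe_X]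

/-- If negating the even power sums of `Y` does not change the value of `F` on the power sums of
`X` and `Y`, then `F` does not involve the even power sums. -/
theorem mem_supported_of_aeval_eq [CharZero K] {F : MvPolynomial ℕ K}
    (h : ∀ k l, MvPolynomial.aeval (powerSumFin K False k l) F =
      MvPolynomial.aeval (powerSumFin K True k l) F) :
    F ∈ MvPolynomial.supported K {n | Even n} := by
  obtain ⟨L, _, _, _, _, f, hf⟩ := exists_injective_algHom_isAlgClosed K
  obtain ⟨N, hN⟩ := exists_vars_lt K F
  -- choose `X` and `Y` with the same even power sums and with the odd power sums of `Y` zero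
  obtain ⟨k, y, hy⟩ := exists_powerSum_eq
    (fun n => if Even n then f (MvPolynomial.X n) else f (MvPolynomial.X n) / 2) N
  obtain ⟨l, z, hz⟩ := exists_powerSum_eq
    (fun n => if Even n then 0 else f (MvPolynomial.X n) / 2) N
  have h1 := h k l
  rw [aeval_powerSumFin_eq, aeval_powerSumFin_eq, MvPolynomial.coe_inj] at h1
  have h2 := congrArg (MvPolynomial.aeval fun a => Sum.elim y z (ofLex a)) h1
  rw [MvPolynomial.comp_aeval_apply, MvPolynomial.comp_aeval_apply] at h2
  have h3 : ∀ (primed : Prop) (n : ℕ), MvPolynomial.aeval (fun a => Sum.elim y z (ofLex a))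
      (∑ a : Fin k ⊕ₗ Fin l, letterPower ((ofLex a).isRight = true ∧ primed)
        (MvPolynomial.X a : MvPolynomial _ K) n) =
      ∑ a : Fin k ⊕ₗ Fin l, letterPower ((ofLex a).isRight = true ∧ primed)
        (Sum.elim y z (ofLex a)) n := by
    intro primed n
    rw [map_sum]
    exact Finset.sum_congr rfl fun a _ => by rw [map_letterPower, MvPolynomial.aeval_X]
  simp only [h3, sum_letterPower_lex, if_true, if_false] at h2
  have h4 : f F = f (MvPolynomial.aeval
      (fun n => if Even n then (MvPolynomial.X n : MvPolynomial ℕ K) else 0) F) := by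
    rw [MvPolynomial.comp_aeval_apply, ← MvPolynomial.aeval_X_left_apply F,
      MvPolynomial.comp_aeval_apply, MvPolynomial.aeval_X_left_apply]
    refine (aeval_congr_of_vars K fun n hn => ?_).trans
      (h2.trans (aeval_congr_of_vars K fun n hn => ?_))
    · rw [hy n (hN n hn), hz n (hN n hn)]
      split_ifs
      · rw [add_zero]
      · rw [add_halves]
    · rw [hy n (hN n hn), hz n (hN n hn)]
      split_ifs with hev
      · rw [mul_zero, add_zero]
      · rw [(Nat.not_even_iff_odd.1 hev).neg_one_pow, map_zero]
        ring
  rw [hf h4]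
  refine aeval_mem_subalgebra K (fun n => ?_) F
  split_ifs with hev
  · exact MvPolynomial.X_mem_supported.2 hev
  · exact zero_mem _

theorem aeval_eq_of_mem_supported {F : MvPolynomial ℕ K}
    (hF : F ∈ MvPolynomial.supported K {n | Even n}) (k l : ℕ) :
    MvPolynomial.aeval (powerSumFin K False k l) F =
      MvPolynomial.aeval (powerSumFin K True k l) F := by
  refine aeval_congr_of_vars K fun n hn => ?_
  have hev : Even n := MvPolynomial.mem_supported.1 hF hn
  refine Finset.sum_congr rfl fun a _ => ?_
  simp only [letterPower, hev.neg_one_pow, one_mul, ite_self]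

end Independence

/-! ### Sums of hook Schur functions -/

section Hooks

theorem rowLen_eq_of_forall {lam : YoungDiagram} {i m : ℕ} (h : ∀ j, (i, j) ∈ lam ↔ j < m) :
    lam.rowLen i = m := by
  have h1 := h m
  have h2 := h (lam.rowLen i)
  rw [YoungDiagram.mem_iff_lt_rowLen] at h1 h2
  omega

/-- The partition with a single part `b`, or the empty partition if `b = 0`. -/
def oneRow (b : ℕ) : YoungDiagram := ofRowFun fun i => if i = 0 then b else 0

theorem rowLen_oneRow (b i : ℕ) : (oneRow b).rowLen i = if i = 0 then b else 0 := by
  refine rowLen_ofRowFun (N := 1) (f := fun i => if i = 0 then b else 0) (fun i j hij => ?_)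
    (by simp) i
  dsimp only
  split_ifs <;> omega

theorem rowLen_oneRow_transpose (b i : ℕ) :
    (oneRow b).transpose.rowLen i = if i < b then 1 else 0 := by
  refine rowLen_eq_of_forall fun j => ?_
  rw [YoungDiagram.mem_transpose, Prod.swap_prod_mk, YoungDiagram.mem_iff_lt_rowLen,
    rowLen_oneRow]
  split_ifs <;> omega

theorem rowLen_bot (i : ℕ) : (⊥ : YoungDiagram).rowLen i = 0 :=
  rowLen_eq_of_forall fun j => by simp

theorem stripsAbove_bot (b : ℕ) : stripsAbove b ⊥ = {oneRow b} := by
  ext nu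
  rw [mem_stripsAbove, Finset.mem_singleton, isStrip_false_iff]
  have hcard : ∀ nu : YoungDiagram, nu.rowLen 1 = 0 → nu.card = nu.rowLen 0 := fun nu h => by
    rw [card_eq_sum_rowLen nu (colLen_zero_le_iff.2 h), Finset.sum_range_one]
  have hbot : (⊥ : YoungDiagram).card = 0 := rfl
  constructor
  · rintro ⟨h1, h2⟩
    simp only [rowLen_bot] at h1
    refine ext_rowLen fun i => ?_
    rw [rowLen_oneRow]
    have h3 := hcard nu (Nat.le_zero.1 (h1 0).2)
    cases i with
    | zero => rw [if_pos rfl]; omega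
    | succ i => rw [if_neg (Nat.succ_ne_zero i)]; exact Nat.le_zero.1 (h1 i).2
  · rintro rfl
    refine ⟨fun i => by simp [rowLen_bot, rowLen_oneRow], ?_⟩
    rw [hcard _ (by simp [rowLen_oneRow]), rowLen_oneRow, if_pos rfl, hbot, zero_add]

theorem rowLen_hookShape {a : ℕ} (b : ℕ) (ha : 1 ≤ a) (i : ℕ) :
    (hookShape a b ha).rowLen i = if i = 0 then a else if i ≤ b then 1 else 0 := by
  refine rowLen_eq_of_forall fun j => ?_
  rw [hookShape, YoungDiagram.mem_ofRowLens]
  cases i with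
  | zero => simp
  | succ i =>
    simp only [List.length_cons, List.length_replicate, List.getElem_cons_succ,
      List.getElem_replicate, Nat.succ_ne_zero, if_false, exists_prop]
    split_ifs <;> omega

theorem card_hookShape {a : ℕ} (b : ℕ) (ha : 1 ≤ a) : (hookShape a b ha).card = a + b := by
  rw [card_eq_sum_rowLen (N := b + 1), Finset.sum_range_succ', rowLen_hookShape, if_pos rfl,
    Finset.sum_congr rfl fun i hi => show _ = 1 from ?_]
  · simp [add_comm]
  · rw [rowLen_hookShape, if_neg (Nat.succ_ne_zero i), if_pos (Nat.succ_le_of_lt (Finset.mem_range.1 hi))]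
  · rw [colLen_zero_le_iff, rowLen_hookShape, if_neg (Nat.succ_ne_zero b), if_neg (by omega)]

theorem card_oneRow_transpose (b : ℕ) : (oneRow b).transpose.card = b := by
  rw [card_eq_sum_rowLen (N := b), Finset.sum_congr rfl fun i hi => show _ = 1 from ?_]
  · simp
  · rw [rowLen_oneRow_transpose, if_pos (Finset.mem_range.1 hi)]
  · rw [colLen_zero_le_iff, rowLen_oneRow_transpose, if_neg (lt_irrefl b)]

theorem stripsAbove_oneColumn_zero (a : ℕ) :
    stripsAbove (a + 1) (oneRow 0).transpose = {hookShape (a + 1) 0 (Nat.succ_pos a)} := by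
  have h0 : (oneRow 0).transpose = ⊥ := ext_rowLen fun i => by
    rw [rowLen_oneRow_transpose, rowLen_bot, if_neg (Nat.not_lt_zero i)]
  rw [h0, stripsAbove_bot]
  congr 1
  refine ext_rowLen fun i => ?_
  rw [rowLen_oneRow, rowLen_hookShape]
  split_ifs <;> omega

/-- A horizontal strip is added to a column at the end of its first row, and
possibly at the bottom. -/
theorem stripsAbove_oneColumn_succ (a c : ℕ) :
    stripsAbove (a + 1) (oneRow (c + 1)).transpose =
      {hookShape (a + 1) (c + 1) (Nat.succ_pos a), hookShape (a + 2) c (Nat.succ_pos _)} := by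
  ext nu
  rw [mem_stripsAbove, Finset.mem_insert, Finset.mem_singleton, isStrip_false_iff,
    card_oneRow_transpose]
  simp only [rowLen_oneRow_transpose]
  constructor
  · rintro ⟨h1, h2⟩
    have h3 : 1 ≤ nu.rowLen 0 := by
      have := (h1 0).1
      rw [if_pos (Nat.succ_pos c)] at this
      exact this
    have h4 : nu.rowLen (c + 1) ≤ 1 := by
      have := (h1 c).2
      rwa [if_pos (Nat.lt_succ_self c)] at this
    have h5 : nu = hookShape (nu.rowLen 0) (c + nu.rowLen (c + 1)) h3 := by
      refine ext_rowLen fun i => ?_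
      rw [rowLen_hookShape]
      split_ifs with hi hi'
      · rw [hi]
      · obtain ⟨i, rfl⟩ := Nat.exists_eq_succ_of_ne_zero hi
        rcases Nat.lt_or_ge (i + 1) (c + 1) with hlt | hge
        · have e1 := (h1 (i + 1)).1
          have e2 := (h1 i).2
          rw [if_pos hlt] at e1
          rw [if_pos (by omega)] at e2
          exact le_antisymm e2 e1
        · obtain rfl : i = c := by simp only [Nat.succ_eq_add_one] at hi'; omega
          simp only [Nat.succ_eq_add_one] at hi' ⊢
          omega
      · obtain ⟨i, rfl⟩ := Nat.exists_eq_succ_of_ne_zero hi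
        simp only [Nat.succ_eq_add_one] at hi' ⊢
        rcases Nat.lt_or_ge i (c + 1) with hlt | hge
        · obtain rfl : i = c := by omega
          omega
        · have e2 := (h1 i).2
          rw [if_neg (by omega)] at e2
          omega
    have h6 := card_hookShape (c + nu.rowLen (c + 1)) h3
    rw [← h5, h2] at h6
    generalize nu.rowLen 0 = x at h3 h5 h6
    generalize nu.rowLen (c + 1) = y at h4 h5 h6
    rcases Nat.le_one_iff_eq_zero_or_eq_one.1 h4 with rfl | rfl
    · obtain rfl : x = a + 2 := by omega
      exact Or.inr h5
    · obtain rfl : x = a + 1 := by omega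
      exact Or.inl h5
  · rintro (rfl | rfl)
    · refine ⟨fun i => ?_, by rw [card_hookShape]; omega⟩
      rw [rowLen_hookShape, rowLen_hookShape, if_neg (Nat.succ_ne_zero i)]
      split_ifs <;> omega
    · refine ⟨fun i => ?_, by rw [card_hookShape]; omega⟩
      rw [rowLen_hookShape, rowLen_hookShape, if_neg (Nat.succ_ne_zero i)]
      split_ifs <;> omega

theorem oneColumn_eq_hookShape (c : ℕ) :
    (oneRow (c + 1)).transpose = hookShape 1 c le_rfl := by
  refine ext_rowLen fun i => ?_
  rw [rowLen_oneRow_transpose, rowLen_hookShape]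
  split_ifs <;> omega

variable (K : Type u) [Field K]

/-- The Schur function of the hook `(a, 1^b)`, or zero if `a = 0`. -/
def hookTerm (a b : ℕ) : MvPowerSeries ℕ K :=
  if h : 1 ≤ a then schur K (hookShape a b h) else 0

/-- The product of a complete and an elementary symmetric function is a sum of two hook Schur
functions, in general. -/
theorem pieriSum_oneColumn (a b : ℕ) (hab : a + b ≠ 0) :
    pieriSum a (schur K) (oneRow b).transpose =
      hookTerm K a b + if b = 0 then 0 else hookTerm K (a + 1) (b - 1) := by
  cases a with
  | zero =>
    obtain ⟨c, rfl⟩ := Nat.exists_eq_succ_of_ne_zero (n := b) (by omega)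
    rw [pieriSum_zero, oneColumn_eq_hookShape, hookTerm, dif_neg (by omega), zero_add,
      if_neg (Nat.succ_ne_zero c), hookTerm, dif_pos le_rfl]
    rfl
  | succ a =>
    cases b with
    | zero =>
      rw [pieriSum, stripsAbove_oneColumn_zero, Finset.sum_singleton, if_pos rfl, add_zero,
        hookTerm, dif_pos]
    | succ c =>
      rw [pieriSum, stripsAbove_oneColumn_succ, Finset.sum_pair, if_neg (Nat.succ_ne_zero c),
        hookTerm, hookTerm, dif_pos, dif_pos]
      · rfl
      · intro h
        have := congrArg (fun lam => lam.rowLen 0) h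
        simp [rowLen_hookShape] at this

variable [CharZero K]

theorem isNewton_complete {R : Type*} [CommRing R] [Algebra K R] (p : ℕ → R) :
    IsNewton (PowerSeries.mk fun n => MvPolynomial.aeval p (complete K n)) p := by
  refine ⟨?_, ?_⟩
  · rw [← PowerSeries.coeff_zero_eq_constantCoeff_apply, PowerSeries.coeff_mk, complete_zero,
      map_one]
  · ext n
    have h := congrArg (MvPolynomial.aeval p) (smul_complete_succ K n)
    rw [map_smul, map_sum, Algebra.smul_def, map_add, map_natCast, map_one] at h
    rw [PowerSeries.coeff_derivative, PowerSeries.coeff_mk, mul_comm, h, PowerSeries.coeff_mul,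
      Finset.Nat.sum_antidiagonal_eq_sum_range_succ_mk]
    refine Finset.sum_congr rfl fun i _ => ?_
    rw [map_mul, MvPolynomial.aeval_X, PowerSeries.coeff_mk, PowerSeries.coeff_mk]

theorem aeval_add_complete {R : Type*} [CommRing R] [Algebra K R] (p p' : ℕ → R) (n : ℕ) :
    MvPolynomial.aeval (p + p') (complete K n) = ∑ ij ∈ Finset.HasAntidiagonal.antidiagonal n,
      MvPolynomial.aeval p (complete K ij.1) * MvPolynomial.aeval p' (complete K ij.2) := by
  rw [← ((isNewton_complete K p).mul (isNewton_complete K p')).coeff_eq, PowerSeries.coeff_mul]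
  simp only [PowerSeries.coeff_mk]

/-- The elementary symmetric functions are the Schur functions of the columns. -/
theorem schur_oneColumn (b : ℕ) : schur K (oneRow b).transpose =
    MvPolynomial.aeval (fun n => (-1) ^ n * powerSum K (n + 1)) (complete K b) := by
  have h : IsSchurFamily K (fun n => (-1) ^ n * powerSum K (n + 1))
      (fun lam => tableauSeries K (fun _ : ℕ => True) lam ⊥) :=
    isSchurFamily_tableauSeries (fun _ => True) fun s n => by
      rw [map_mul, map_pow, map_neg, map_one, truncate_powerSum, Finset.mul_sum]
      simp only [letterPower, if_true]
  have h1 := congrFun (h.pieri b) ⊥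
  rw [pieriSum, stripsAbove_bot, Finset.sum_singleton, Pi.smul_apply, h.bot, smul_eq_mul,
    mul_one] at h1
  have hbot : (⊥ : YoungDiagram).transpose = ⊥ := by
    ext c
    simp
  rw [← h1, ← tableauSeries_transpose, hbot]
  rfl

/-- The power sums of the alphabet consisting of an unprimed and a primed copy of the variables:
twice the odd power sums, and zero in even degrees. -/
def doubledPowerSum (K : Type u) [Field K] (n : ℕ) : MvPowerSeries ℕ K :=
  (1 + (-1) ^ n) * powerSum K (n + 1)

/-- Each hook of size `n` arises from exactly two columns by adding a horizontal strip: its own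
first column, and that column without the bottom cell. -/
theorem aeval_doubledPowerSum_complete (n : ℕ) (hn : 1 ≤ n) :
    MvPolynomial.aeval (doubledPowerSum K) (complete K n) = 2 * hookSum K n := by
  have hp : doubledPowerSum K =
      (fun n => powerSum K (n + 1)) + fun n => (-1) ^ n * powerSum K (n + 1) := by
    funext n
    rw [doubledPowerSum, add_mul, one_mul, Pi.add_apply]
  have hpieri : ∀ ij ∈ Finset.HasAntidiagonal.antidiagonal n,
      MvPolynomial.aeval (fun n => powerSum K (n + 1)) (complete K ij.1) *
        MvPolynomial.aeval (fun n => (-1) ^ n * powerSum K (n + 1)) (complete K ij.2) =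
      hookTerm K ij.1 ij.2 + if ij.2 = 0 then 0 else hookTerm K (ij.1 + 1) (ij.2 - 1) := by
    intro ij hij
    rw [Finset.HasAntidiagonal.mem_antidiagonal] at hij
    rw [← schur_oneColumn, ← pieriSum_oneColumn K ij.1 ij.2 (by omega),
      (isSchurFamily_schur K).pieri, Pi.smul_apply, smul_eq_mul]
  have hsum : hookSum K n =
      ∑ ij ∈ Finset.HasAntidiagonal.antidiagonal n, hookTerm K ij.1 ij.2 := rfl
  rw [hp, aeval_add_complete, Finset.sum_congr rfl hpieri, Finset.sum_add_distrib, ← hsum, two_mul]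
  congr 1
  obtain ⟨m, rfl⟩ := Nat.exists_eq_add_of_le' hn
  rw [Finset.Nat.sum_antidiagonal_succ', if_pos rfl, zero_add, hsum,
    Finset.Nat.sum_antidiagonal_succ, hookTerm, dif_neg (by omega), zero_add]
  exact Finset.sum_congr rfl fun ij _ => if_neg (Nat.succ_ne_zero _)

end Hooks

/-! ### The space of doubly symmetric functions -/

section Main

variable {K : Type u} [Field K]

theorem isSchurFamily_schurFin [CharZero K] (k l : ℕ) :
    IsSchurFamily K (powerSumFin K False k l) (schurFin K k l) := by
  have h := isSchurFamily_tableauSeries_of_fintype (K := K) (A := Fin k ⊕ₗ Fin l)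
    (fun _ => False)
  have e : powerSumFin K False k l = fun n => ∑ a : Fin k ⊕ₗ Fin l,
      letterPower (False) (MvPowerSeries.X a) n := by
    funext n
    simp only [powerSumFin, and_false]
  rw [e]
  exact h

theorem isSchurFamily_hookSchur [CharZero K] (k l : ℕ) :
    IsSchurFamily K (powerSumFin K True k l) (hookSchur K k l) := by
  have h := isSchurFamily_tableauSeries_of_fintype (K := K) (A := Fin k ⊕ₗ Fin l)
    (fun a => (ofLex a).isRight = true)
  have e : powerSumFin K True k l = fun n => ∑ a : Fin k ⊕ₗ Fin l,
      letterPower ((ofLex a).isRight = true) (MvPowerSeries.X a) n := by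
    funext n
    simp only [powerSumFin, and_true]
  rw [e]
  exact h

theorem IsSchurFamily.linearCombination_eq {R : Type u} [CommRing R] [Algebra K R] {p : ℕ → R}
    {S : YoungDiagram → R} (h : IsSchurFamily K p S) (m : YoungDiagram →₀ K) :
    Finsupp.linearCombination K S m =
      MvPolynomial.aeval p (Finsupp.linearCombination K (schurPoly K) m) := by
  rw [Finsupp.linearCombination_apply, Finsupp.linearCombination_apply, map_finsuppSum]
  refine Finsupp.sum_congr fun lam _ => ?_
  rw [map_smul, h.eq_aeval]

variable (K)

theorem powerSum_mem_symmetricFunctions (n : ℕ) :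
    powerSum K (n + 1) ∈ symmetricFunctions K := by
  refine ⟨⟨n + 1, fun d hd => if_neg ?_⟩, fun σ d => ?_⟩
  · rintro ⟨i, rfl⟩
    simp at hd
  · change (if _ then (1 : K) else 0) = if _ then (1 : K) else 0
    refine if_congr ⟨?_, ?_⟩ rfl rfl
    · rintro ⟨i, hi⟩
      refine ⟨σ.symm i, Finsupp.mapDomain_injective σ.injective ?_⟩
      rw [hi, Finsupp.mapDomain_single, Equiv.apply_symm_apply]
    · rintro ⟨i, rfl⟩
      exact ⟨σ i, Finsupp.mapDomain_single⟩

/-- The doubly symmetric functions are the polynomials in the odd power sums. -/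
theorem doublySymmetric_eq_map [CharZero K] : doublySymmetric K =
    Subalgebra.toSubmodule ((MvPolynomial.supported K {n | Even n}).map (evalPowerSums K)) := by
  ext f
  constructor
  · rintro ⟨-, m, rfl, hm⟩
    refine ⟨Finsupp.linearCombination K (schurPoly K) m, mem_supported_of_aeval_eq fun k l => ?_,
      ((isSchurFamily_schur K).linearCombination_eq m).symm⟩
    rw [← (isSchurFamily_schurFin k l).linearCombination_eq, hm,
      (isSchurFamily_hookSchur k l).linearCombination_eq]
  · rintro ⟨F, hF, rfl⟩
    obtain ⟨m, hm⟩ := exists_schur_expansion F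
    refine ⟨aeval_mem_subalgebra K (powerSum_mem_symmetricFunctions K) F, m,
      hm _ _ _ (isSchurFamily_schur K), fun k l => ?_⟩
    rw [← hm _ _ _ (isSchurFamily_schurFin k l), ← hm _ _ _ (isSchurFamily_hookSchur k l)]
    exact aeval_eq_of_mem_supported hF k l

theorem adjoin_odd_powerSum :
    Algebra.adjoin K {f | ∃ n : ℕ, Odd n ∧ f = powerSum K n} =
      (MvPolynomial.supported K {n | Even n}).map (evalPowerSums K) := by
  rw [MvPolynomial.supported_eq_adjoin_X, AlgHom.map_adjoin]
  congr 1
  ext f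
  simp only [Set.mem_ofPred_eq, Set.mem_image, exists_exists_and_eq_and, evalPowerSums,
    MvPolynomial.aeval_X]
  constructor
  · rintro ⟨n, hn, rfl⟩
    obtain ⟨m, rfl⟩ := hn
    exact ⟨2 * m, even_two_mul m, rfl⟩
  · rintro ⟨n, hn, rfl⟩
    exact ⟨n + 1, hn.add_one, rfl⟩

/-! ### The basis of odd power sum products -/

/-- The exponent vector of `p_lam` as a monomial in the power sums; the variable `X n` stands for
the power sum of degree `n + 1`. -/
def partExponent (lam : YoungDiagram) : ℕ →₀ ℕ :=
  Multiset.toFinsupp ((lam.rowLens : Multiset ℕ).map fun r => r - 1)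

theorem powerSumPart_eq (lam : YoungDiagram) :
    powerSumPart K lam = evalPowerSums K (MvPolynomial.monomial (partExponent lam) 1) := by
  have key : ∀ l : List ℕ, (∀ r ∈ l, 0 < r) → (l.map (powerSum K)).prod =
      evalPowerSums K (MvPolynomial.monomial
        (Multiset.toFinsupp ((l : Multiset ℕ).map fun r => r - 1)) 1) := by
    intro l hl
    induction l with
    | nil => simp
    | cons r l ih =>
      have h1 : powerSum K r = evalPowerSums K (MvPolynomial.X (r - 1)) := by
        rw [evalPowerSums, MvPolynomial.aeval_X, Nat.sub_add_cancel (hl r List.mem_cons_self)]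
      rw [List.map_cons, List.prod_cons, ih fun s hs => hl s (List.mem_cons_of_mem _ hs), h1,
        ← map_mul, ← Multiset.cons_coe, Multiset.map_cons, ← Multiset.singleton_add,
        Multiset.toFinsupp_add, Multiset.toFinsupp_singleton, MvPolynomial.X,
        MvPolynomial.monomial_mul, one_mul]
  exact key _ lam.pos_of_mem_rowLens

theorem partExponent_injective : Function.Injective partExponent := by
  intro lam mu h
  have h1 := congrArg (Multiset.map fun n => n + 1) (Multiset.toFinsupp.injective h)
  have h2 : ∀ nu : YoungDiagram, Multiset.map (fun n => n + 1)
      ((nu.rowLens : Multiset ℕ).map fun r => r - 1) = nu.rowLens := by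
    intro nu
    rw [Multiset.map_map, Multiset.map_congr rfl fun r hr => show _ = id r from ?_, Multiset.map_id]
    exact Nat.sub_add_cancel (nu.pos_of_mem_rowLens r hr)
  rw [h2, h2, Multiset.coe_eq_coe] at h1
  have h3 : lam.rowLens = mu.rowLens :=
    h1.eq_of_sortedGE lam.rowLens_sorted mu.rowLens_sorted
  exact YoungDiagram.equivListRowLens.injective (Subtype.ext h3)

theorem exists_partExponent_eq {d : ℕ →₀ ℕ} (hd : ∀ n ∈ d.support, Even n) :
    ∃ lam : YoungDiagram, IsOddPartition lam ∧ partExponent lam = d := by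
  have hmem : ∀ r ∈ ((Finsupp.toMultiset d).map fun n => n + 1).sort (· ≥ ·),
      ∃ n ∈ d.support, n + 1 = r := fun r hr => by
    simpa only [Multiset.mem_sort, Multiset.mem_map, Finsupp.mem_toMultiset] using hr
  have hlens : (YoungDiagram.ofRowLens _ (Multiset.pairwise_sort
      ((Finsupp.toMultiset d).map fun n => n + 1) (· ≥ ·)).sortedGE).rowLens =
      ((Finsupp.toMultiset d).map fun n => n + 1).sort (· ≥ ·) :=
    YoungDiagram.rowLens_ofRowLens_eq_self fun r hr => by
      obtain ⟨n, -, rfl⟩ := hmem r hr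
      exact Nat.succ_pos n
  refine ⟨YoungDiagram.ofRowLens _ (Multiset.pairwise_sort
      ((Finsupp.toMultiset d).map fun n => n + 1) (· ≥ ·)).sortedGE, fun r hr => ?_, ?_⟩
  · rw [hlens] at hr
    obtain ⟨n, hn, rfl⟩ := hmem r hr
    exact (hd n hn).add_one
  · rw [partExponent, hlens, Multiset.sort_eq, Multiset.map_map]
    simp

theorem linearIndependent_powerSumPart [CharZero K] :
    LinearIndependent K (fun lam : {lam : YoungDiagram // IsOddPartition lam} =>
      powerSumPart K lam.1) := by
  have h1 := (MvPolynomial.basisMonomials ℕ K).linearIndependent.comp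
    (fun lam : {lam : YoungDiagram // IsOddPartition lam} => partExponent lam.1)
    (partExponent_injective.comp Subtype.val_injective)
  have h2 := h1.map' (evalPowerSums K).toLinearMap
    (LinearMap.ker_eq_bot.2 (evalPowerSums_injective K))
  have e : (fun lam : {lam : YoungDiagram // IsOddPartition lam} => powerSumPart K lam.1) =
      (evalPowerSums K).toLinearMap ∘ MvPolynomial.basisMonomials ℕ K ∘
        fun lam : {lam : YoungDiagram // IsOddPartition lam} => partExponent lam.1 := by
    funext lam
    rw [powerSumPart_eq]
    simp
  rw [e]
  exact h2

theorem span_powerSumPart [CharZero K] :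
    Submodule.span K (Set.range (fun lam : {lam : YoungDiagram // IsOddPartition lam} =>
      powerSumPart K lam.1)) = doublySymmetric K := by
  rw [doublySymmetric_eq_map]
  refine le_antisymm (Submodule.span_le.2 ?_) ?_
  · rintro _ ⟨lam, rfl⟩
    rw [SetLike.mem_coe, Subalgebra.mem_toSubmodule, ← adjoin_odd_powerSum]
    refine list_prod_mem fun f hf => ?_
    obtain ⟨r, hr, rfl⟩ := List.mem_map.1 hf
    exact Algebra.subset_adjoin ⟨r, lam.2 r hr, rfl⟩
  · rintro _ ⟨F, hF, rfl⟩
    change evalPowerSums K F ∈ _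
    rw [F.as_sum, map_sum]
    refine sum_mem fun d hd => ?_
    obtain ⟨lam, hodd, hlam⟩ := exists_partExponent_eq (d := d) fun n hn =>
      MvPolynomial.mem_supported.1 hF ((MvPolynomial.mem_vars_iff_mem_support _).2 ⟨d, hd, hn⟩)
    have h1 : MvPolynomial.monomial d (F.coeff d) =
        F.coeff d • MvPolynomial.monomial d (1 : K) := by
      rw [MvPolynomial.smul_monomial, smul_eq_mul, mul_one]
    rw [h1, map_smul, ← hlam, ← powerSumPart_eq]
    exact Submodule.smul_mem _ _ (Submodule.subset_span ⟨⟨lam, hodd⟩, rfl⟩)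

/-! ### Doubly Schur functions and hook sums -/

theorem inv_two_smul_two_mul [CharZero K] {B : Type*} [CommRing B] [Algebra K B] (x : B) :
    (2 : K)⁻¹ • (2 * x) = x := by
  rw [Algebra.smul_def, ← map_ofNat (algebraMap K B) 2, ← mul_assoc, ← map_mul,
    inv_mul_cancel₀ two_ne_zero, map_one, one_mul]

/-- Doubling the alphabet maps all symmetric functions onto the doubly symmetric ones. -/
theorem doublySymmetric_eq_range [CharZero K] : doublySymmetric K =
    Subalgebra.toSubmodule (MvPolynomial.aeval (doubledPowerSum K)).range := by
  rw [doublySymmetric_eq_map]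
  congr 1
  have hmem : ∀ n, doubledPowerSum K n ∈
      (MvPolynomial.supported K {n | Even n}).map (evalPowerSums K) := by
    intro n
    have h : (1 + (-1) ^ n) * MvPolynomial.X n ∈ MvPolynomial.supported K {n | Even n} := by
      rcases Nat.even_or_odd n with hn | hn
      · exact mul_mem (add_mem (one_mem _) (pow_mem (neg_mem (one_mem _)) _))
          (MvPolynomial.X_mem_supported.2 hn)
      · rw [hn.neg_one_pow, add_neg_cancel, zero_mul]
        exact zero_mem _
    refine ⟨_, h, ?_⟩
    change evalPowerSums K _ = _
    rw [map_mul, map_add, map_one, map_pow, map_neg, map_one, doubledPowerSum, evalPowerSums,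
      MvPolynomial.aeval_X]
  refine le_antisymm ?_ ?_
  · rw [← adjoin_odd_powerSum, Algebra.adjoin_le_iff]
    rintro _ ⟨n, ⟨m, rfl⟩, rfl⟩
    refine ⟨(2 : K)⁻¹ • MvPolynomial.X (2 * m), ?_⟩
    change MvPolynomial.aeval (doubledPowerSum K) _ = _
    rw [map_smul, MvPolynomial.aeval_X, doubledPowerSum, (even_two_mul m).neg_one_pow,
      one_add_one_eq_two, inv_two_smul_two_mul]
  · rintro _ ⟨F, rfl⟩
    exact aeval_mem_subalgebra K hmem F

theorem span_doublySchur [CharZero K] :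
    Submodule.span K (Set.range (doublySchur K)) = doublySymmetric K := by
  have hfam : IsSchurFamily K (doubledPowerSum K) (doublySchur K) := isSchurFamily_doublySchur K
  rw [doublySymmetric_eq_range]
  refine le_antisymm (Submodule.span_le.2 ?_) ?_
  · rintro _ ⟨lam, rfl⟩
    exact ⟨schurPoly K lam, (hfam.eq_aeval lam).symm⟩
  · rintro _ ⟨F, rfl⟩
    obtain ⟨m, hm⟩ := exists_schur_expansion F
    change MvPolynomial.aeval (doubledPowerSum K) F ∈ _
    rw [hm _ _ _ hfam, Finsupp.linearCombination_apply]
    exact sum_mem fun lam _ => Submodule.smul_mem _ _ (Submodule.subset_span ⟨lam, rfl⟩)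

theorem adjoin_hookSum [CharZero K] :
    Subalgebra.toSubmodule (Algebra.adjoin K {f | ∃ n : ℕ, 1 ≤ n ∧ f = hookSum K n}) =
      doublySymmetric K := by
  rw [doublySymmetric_eq_range]
  congr 1
  refine le_antisymm (Algebra.adjoin_le ?_) ?_
  · rintro _ ⟨n, hn, rfl⟩
    refine ⟨(2 : K)⁻¹ • complete K n, ?_⟩
    change MvPolynomial.aeval (doubledPowerSum K) _ = _
    rw [map_smul, aeval_doubledPowerSum_complete K n hn, inv_two_smul_two_mul]
  · rw [← Algebra.map_top, ← adjoin_complete, AlgHom.map_adjoin, Algebra.adjoin_le_iff]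
    rintro _ ⟨_, ⟨n, rfl⟩, rfl⟩
    cases n with
    | zero =>
      rw [complete_zero]
      rw [map_one]
      exact one_mem _
    | succ n =>
      rw [aeval_doubledPowerSum_complete K _ (Nat.succ_pos n), two_mul]
      have h : hookSum K (n + 1) ∈
          Algebra.adjoin K {f | ∃ n : ℕ, 1 ≤ n ∧ f = hookSum K n} :=
        Algebra.subset_adjoin ⟨n + 1, Nat.succ_pos n, rfl⟩
      exact add_mem h h

end Main

end DoublySym

end

/-- The space `𝒟` of doubly symmetric functions is (the underlying space of) the algebra generated
by the odd power sums; the `p_lam` with `lam` odd form a basis of it; it is the span of the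
doubly Schur functions; and it is the algebra generated by the `k_n`. -/
theorem corollary3p7 (K : Type*) [Field K] [CharZero K] :
    Subalgebra.toSubmodule (Algebra.adjoin K {f | ∃ n : ℕ, Odd n ∧ f = DoublySym.powerSum K n}) =
        DoublySym.doublySymmetric K ∧
    (LinearIndependent K (fun lam : {lam : YoungDiagram // DoublySym.IsOddPartition lam} =>
        DoublySym.powerSumPart K lam.1) ∧
      Submodule.span K (Set.range
        (fun lam : {lam : YoungDiagram // DoublySym.IsOddPartition lam} =>
          DoublySym.powerSumPart K lam.1)) = DoublySym.doublySymmetric K) ∧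
    Submodule.span K (Set.range (DoublySym.doublySchur K)) = DoublySym.doublySymmetric K ∧
    Subalgebra.toSubmodule
        (Algebra.adjoin K {f | ∃ n : ℕ, 1 ≤ n ∧ f = DoublySym.hookSum K n}) =
      DoublySym.doublySymmetric K := by
  refine ⟨?_, ⟨DoublySym.linearIndependent_powerSumPart K, DoublySym.span_powerSumPart K⟩,
    DoublySym.span_doublySchur K, DoublySym.adjoin_hookSum K⟩
  rw [DoublySym.adjoin_odd_powerSum, DoublySym.doublySymmetric_eq_map]
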